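/- Let $\Lambda$ be a finite set and $\mathcal H$ a nonempty family of functions $\Lambda\to\{0,1\}$ (equivalently, of subsets of $\Lambda$). For $\varepsilon\in(0,1)$ let $\mathsf{sam}(\mathcal H,\varepsilon)$ be the least positive integer $m$ for which there is a (randomized) algorithm that, for every probability distribution $\mu$ on $\Lambda$ and every $f:\Lambda\to\{0,1\}$, receives $m$ labeled samples $(x^{(1)},f(x^{(1)})),\dots,(x^{(m)},f(x^{(m)}))$ with $x^{(1)},\dots,x^{(m)}$ drawn independently from $\mu$, and (1) accepts with probability at least $2/3$ if $f\in\mathcal H$; (2) rejects with probability at least $2/3$ if $\Pr_{x\sim\mu}[f(x)\neq g(x)]\ge\varepsilon$ for every $g\in\mathcal H$. For a simple graph $H$ with at least one edge and a positive integer $n$, let $\mathcal G^{H\text{-free}}_n$ be the family of all $E\subseteq\binom{[n]}{2}$ such that the graph $([n],E)$ has no (not necessarily induced) subgraph isomorphic to $H$. Theorem. For every integer $t\ge 1$ there are constants $\varepsilon_0\in(0,1)$ and $c,C>0$, depending only on $t$, such that for every tree $H$ with $t$ edges, every positive integer $n$ and every $\varepsilon\in(0,\varepsilon_0]$, $$c\,n^{(t-1)/t}\;\le\;\mathsf{sam}\big(\mathcal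 G^{H\text{-free}}_n,\varepsilon\big)\;\le\;\frac{C\,n^{(t-1)/t}}{\varepsilon}.$$ -/

import Mathlib

namespace EdgeTesting

/-- A randomized algorithm that receives `m` labeled samples `(x, f x)` from the domain `Λ`.
Only its input/output behaviour matters for sample complexity, so it is given by the probability
(over its internal randomness) with which it accepts each possible sequence of labeled samples;
with the complementary probability it rejects. -/
abbrev Algorithm (Λ : Type*) (m : ℕ) : Type _ :=
  (Fin m → Λ × Bool) → unitInterval

section

variable {Λ : Type*} [Fintype Λ]

/-- The probability that `A` accepts when it is fed `m` independent samples from the distribution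
with probability mass function `μ`, labeled by `f`. -/
noncomputable def acceptProb {m : ℕ} (A : Algorithm Λ m) (μ : Λ → ℝ) (f : Λ → Bool) : ℝ :=
  ∑ x : Fin m → Λ, (∏ i, μ (x i)) * (A fun i => (x i, f (x i)) : ℝ)

/-- The probability that `A` rejects when it is fed `m` independent samples from the distribution
with probability mass function `μ`, labeled by `f`. -/
noncomputable def rejectProb {m : ℕ} (A : Algorithm Λ m) (μ : Λ → ℝ) (f : Λ → Bool) : ℝ :=
  ∑ x : Fin m → Λ, (∏ i, μ (x i)) * (1 - (A fun i => (x i, f (x i)) : ℝ))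

/-- The probability, for `x` drawn from `μ`, that `f x ≠ g x`. -/
noncomputable def dist (μ : Λ → ℝ) (f g : Λ → Bool) : ℝ :=
  ∑ x with f x ≠ g x, μ x

/-- `A` is a (two-sided error, sample-based) distribution-free tester for the property `P` with
proximity parameter `ε`. `stdSimplex ℝ Λ` is the set of probability mass functions on `Λ`. -/
def IsTester (P : Set (Λ → Bool)) (ε : ℝ) {m : ℕ} (A : Algorithm Λ m) : Prop :=
  ∀ μ ∈ stdSimplex ℝ Λ, ∀ f : Λ → Bool,
    (f ∈ P → 2 / 3 ≤ acceptProb A μ f) ∧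
    ((∀ g ∈ P, ε ≤ dist μ f g) → 2 / 3 ≤ rejectProb A μ f)

/-- The sample complexity: the least positive integer `m` such that some algorithm taking `m`
labeled samples is a tester. (The value is `0` exactly if there is no such `m`, so that a positive
lower bound on `sam` includes the existence of a tester.) -/
noncomputable def sam (P : Set (Λ → Bool)) (ε : ℝ) : ℕ :=
  sInf {m : ℕ | 0 < m ∧ ∃ A : Algorithm Λ m, IsTester P ε A}

end

/-- The two-element subsets of an `n`-element vertex set. -/
abbrev Edge (n : ℕ) : Type := {e : Sym2 (Fin n) // ¬ e.IsDiag}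

/-- The simple graph on `n` vertices whose edges are those with indicator `true`. -/
def toGraph {n : ℕ} (f : Edge n → Bool) : SimpleGraph (Fin n) :=
  SimpleGraph.fromEdgeSet {e | ∃ h : ¬ e.IsDiag, f ⟨e, h⟩ = true}

/-- The (indicator functions of) edge sets on `n` vertices that contain no copy of `H` as a
(not necessarily induced) subgraph. -/
def freeProperty {V : Type*} (H : SimpleGraph V) (n : ℕ) : Set (Edge n → Bool) :=
  {f | H.Free (toGraph f)}

end EdgeTesting

/-! Upper bound. The tester looks for a copy of `H` among the sampled edges, so it never rejects an
`H`-free graph. Suppose `f` is `ε`-far. A greedy fractional packing of copies, with the edge masses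
of `μ` as capacities, has total weight at least `ε / t`, because deleting all saturated edges
destroys every copy (`exists_packing_of_far`). Passing to copies that respect a vertex colouring,
and then to a vertex set on which every used vertex carries weight of order `ε / n`, loses only a
factor depending on `t` (`exists_robust_packing`).

The packing is then replaced by the Markov process along the tree with the same vertex and edge
marginals. Its configurations consist of edges of `f`, and the colours make them injective, so each
is a copy. Let `X` be the weighted count of configurations whose `i`-th edge is sampled in the
`i`-th of `t` independent blocks of `m` samples, normalised to have mean the total weight `W`. The
Markov property bounds the variance: a coincidence on an edge costs `1 / (m p)`, where `p` is the
mass of its parent vertex, and this is at most `θ`, of order `n / (m ε)`. Hence `Var X ≤ t (1 + θ) ^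
(t - 1) W / m` (`IsFlow.sum_pair_prod_le`), and Chebyshev gives failure probability at most `1 / 3`
once `m` is of order `n ^ ((t - 1) / t) / ε` (`sum_not_covers_le`, `le_third_of_second_moment`).

Lower bound. For each of `B` rows, with `B` of order `n`, place disjoint copies of `V` indexed by
the even vectors `z` over the edges of `H`. Position `e` of copy `(b, z)` is an edge iff `s b e + z
e = 1` for a secret `s`. If the rows of `s` have the parity of `t`, then `z = s b + 1` is even and
every row contains a full copy of `H`; with the other parity no copy is full and the graph is
`H`-free. The parity of a row stays hidden until all its `t` positions have been sampled, and some
row is fully seen with probability at most `B (m / (t B)) ^ t` (`third_le_of_isTester`). So `m` must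
be of order `B ^ ((t - 1) / t)`. -/

namespace EdgeTesting

/-! ### Tree-indexed Markov processes and their pair correlations -/

/-- Sequences of `k + 1` elements of `α`, built by appending one element at a time. -/
def Growth (α : Type*) : ℕ → Type _
  | 0 => α
  | k + 1 => Growth α k × α

namespace Growth

variable {α : Type*}

instance instFintype [Fintype α] : ∀ k, Fintype (Growth α k)
  | 0 => inferInstanceAs (Fintype α)
  | k + 1 => by
    haveI := instFintype k
    exact inferInstanceAs (Fintype (Growth α k × α))

/-- The `j`-th entry of a sequence (meaningful for `j ≤ k`). -/
def coord : ∀ k, Growth α k → ℕ → α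
  | 0, v => fun _ => v
  | k + 1, c => Function.update (coord k c.1) (k + 1) c.2

/-- The weight of a sequence under the process that starts with the measure `p₀` and appends the
`(k+1)`-st entry by applying the kernel `T k` to the entry with index `π k`. -/
def weight (p₀ : α → ℝ) (π : ℕ → ℕ) (T : ℕ → α → α → ℝ) : ∀ k, Growth α k → ℝ
  | 0, v => p₀ v
  | k + 1, c => weight p₀ π T k c.1 * T k (coord k c.1 (π k)) c.2

theorem sum_succ [Fintype α] {k : ℕ} (F : Growth α (k + 1) → ℝ) :
    ∑ c, F c = ∑ c : Growth α k, ∑ u : α, F (c, u) :=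
  Fintype.sum_prod_type (f := (F : Growth α k × α → ℝ))

theorem coord_succ_last {k : ℕ} (c : Growth α k) (u : α) :
    coord (k + 1) (c, u) (k + 1) = u := by
  simp [coord]

theorem coord_succ_of_le {k j : ℕ} (h : j ≤ k) (c : Growth α k) (u : α) :
    coord (k + 1) (c, u) j = coord k c j := by
  simp [coord, Function.update_of_ne (show j ≠ k + 1 by omega)]

end Growth

open Growth

/-- Vertex masses `p j` (`j ≤ t`) and edge masses `x i` (`i < t`) that are consistent along the tree
in which the vertex `i + 1` is attached to the vertex `π i`. -/
structure IsFlow {α : Type*} [Fintype α] (t : ℕ) (π : ℕ → ℕ) (p : ℕ → α → ℝ)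
    (x : ℕ → α → α → ℝ) : Prop where
  parent_le : ∀ i, π i ≤ i
  p_nonneg : ∀ j v, 0 ≤ p j v
  x_nonneg : ∀ i v u, 0 ≤ x i v u
  sum_right : ∀ i < t, ∀ v, ∑ u, x i v u = p (π i) v
  sum_left : ∀ i < t, ∀ u, ∑ v, x i v u = p (i + 1) u

open Classical in
/-- The transition kernel of a flow: the conditional distribution of the new vertex. -/
noncomputable def flowKernel {α : Type*} (π : ℕ → ℕ) (p : ℕ → α → ℝ) (x : ℕ → α → α → ℝ)
    (i : ℕ) (v u : α) : ℝ :=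
  -- Staying put at massless vertices keeps the kernel stochastic at every vertex.
  if p (π i) v = 0 then (if u = v then 1 else 0) else x i v u / p (π i) v

open Classical in
/-- The excess factor of the edge `i` for a pair of sequences: `1 / (m x)` if both use the same
edge, and `0` otherwise. -/
noncomputable def collision {α : Type*} (π : ℕ → ℕ) (x : ℕ → α → α → ℝ) (m : ℝ) (i : ℕ)
    (C C' : ℕ → α) : ℝ :=
  if C (π i) = C' (π i) ∧ C (i + 1) = C' (i + 1) then (m * x i (C (π i)) (C (i + 1)))⁻¹ else 0

namespace IsFlow

variable {α : Type*} [Fintype α] {t : ℕ} {π : ℕ → ℕ} {p : ℕ → α → ℝ} {x : ℕ → α → α → ℝ}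

local notation "K" => flowKernel π p x
local notation "ω" => Growth.weight (p 0) π (flowKernel π p x)

theorem kernel_nonneg (h : IsFlow t π p x) (i : ℕ) (v u : α) : 0 ≤ K i v u := by
  unfold flowKernel
  have := h.p_nonneg (π i) v
  have := h.x_nonneg i v u
  split_ifs <;> positivity

theorem sum_kernel (h : IsFlow t π p x) {i : ℕ} (hi : i < t) (v : α) : ∑ u, K i v u = 1 := by
  classical
  unfold flowKernel
  split_ifs with h0
  · rw [Finset.sum_ite_eq' Finset.univ v (fun _ => (1 : ℝ)), if_pos (Finset.mem_univ v)]
  · rw [← Finset.sum_div, h.sum_right i hi, div_self h0]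

theorem x_eq_zero (h : IsFlow t π p x) {i : ℕ} (hi : i < t) {v : α} (h0 : p (π i) v = 0) (u : α) :
    x i v u = 0 := by
  have := h.sum_right i hi v
  rw [h0, Finset.sum_eq_zero_iff_of_nonneg (fun _ _ => h.x_nonneg _ _ _)] at this
  exact this u (Finset.mem_univ _)

theorem p_mul_kernel (h : IsFlow t π p x) {i : ℕ} (hi : i < t) (v u : α) :
    p (π i) v * K i v u = x i v u := by
  by_cases h0 : p (π i) v = 0
  · rw [h0, zero_mul, h.x_eq_zero hi h0]
  · rw [flowKernel, if_neg h0, mul_div_cancel₀ _ h0]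

theorem weight_nonneg (h : IsFlow t π p x) : ∀ k (c : Growth α k), 0 ≤ ω k c
  | 0, _ => h.p_nonneg _ _
  | k + 1, c => mul_nonneg (weight_nonneg h k c.1) (h.kernel_nonneg _ _ _)

/-- Flow consistency makes the kernel carry `p (π k)` to `p (k + 1)`, while appending an entry
leaves the earlier marginals unchanged. -/
theorem sum_weight_coord (h : IsFlow t π p x) : ∀ k ≤ t, ∀ j ≤ k, ∀ g : α → ℝ,
    ∑ c, ω k c * g (coord k c j) = ∑ v, p j v * g v := by
  intro k
  induction k with
  | zero =>
    intro _ j hj g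
    obtain rfl : j = 0 := by omega
    rfl
  | succ k ih =>
    intro hk j hj g
    rw [sum_succ]
    simp only [Growth.weight]
    rcases Nat.lt_or_ge k j with hlt | hle
    · obtain rfl : j = k + 1 := by omega
      simp only [coord_succ_last, mul_assoc, ← Finset.mul_sum]
      rw [ih (by omega) (π k) (h.parent_le k) (fun v => ∑ u, K k v u * g u)]
      simp only [Finset.mul_sum, ← mul_assoc, h.p_mul_kernel (show k < t by omega)]
      rw [Finset.sum_comm]
      simp only [← Finset.sum_mul, h.sum_left k (by omega)]
    · simp only [coord_succ_of_le hle]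
      rw [← ih (by omega) j hle g]
      refine Finset.sum_congr rfl fun c _ => ?_
      rw [← Finset.sum_mul, ← Finset.mul_sum, h.sum_kernel (by omega), mul_one]

theorem sum_weight (h : IsFlow t π p x) {k : ℕ} (hk : k ≤ t) : ∑ c, ω k c = ∑ v, p 0 v := by
  simpa using h.sum_weight_coord k hk 0 (Nat.zero_le _) 1

theorem p_coord_ne_zero (h : IsFlow t π p x) {k : ℕ} (hk : k ≤ t) {c : Growth α k}
    (hc : ω k c ≠ 0) {j : ℕ} (hj : j ≤ k) : p j (coord k c j) ≠ 0 := by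
  classical
  intro h0
  have := h.sum_weight_coord k hk j hj (fun v => if v = coord k c j then 1 else 0)
  simp only [mul_ite, mul_one, mul_zero, Finset.sum_ite_eq', Finset.mem_univ, if_true, h0] at this
  rw [Finset.sum_eq_zero_iff_of_nonneg] at this
  · exact hc (by simpa using this c (Finset.mem_univ _))
  · intro c' _
    split_ifs
    · exact h.weight_nonneg _ _
    · exact le_rfl

/-- A step of positive kernel weight from a vertex of positive mass uses an edge of positive mass.
This is what later identifies the entries of a configuration with genuine edges. -/
theorem x_coord_ne_zero (h : IsFlow t π p x) : ∀ k ≤ t, ∀ c : Growth α k, ω k c ≠ 0 →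
    ∀ i < k, x i (coord k c (π i)) (coord k c (i + 1)) ≠ 0 := by
  intro k
  induction k with
  | zero => intro _ _ _ i hi; omega
  | succ k ih =>
    rintro hk ⟨c, u⟩ hc i hi
    have hpi := h.parent_le i
    have hc1 : ω k c * K k (coord k c (π k)) u ≠ 0 := hc
    rw [coord_succ_of_le (show π i ≤ k by omega)]
    rcases Nat.lt_or_ge i k with hlt | hle
    · rw [coord_succ_of_le (show i + 1 ≤ k by omega)]
      exact ih (by omega) c (left_ne_zero_of_mul hc1) i hlt
    · obtain rfl : i = k := by omega
      rw [coord_succ_last, ← h.p_mul_kernel (by omega)]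
      exact mul_ne_zero (h.p_coord_ne_zero (by omega) (left_ne_zero_of_mul hc1) hpi)
        (right_ne_zero_of_mul hc1)

-- From a common parent `v`, each `u` contributes `K ^ 2 / (m p K) = K / (m p)`, and `K` sums to
-- `1`. The edge masses cancel, so only the mass of the parent matters.
open Classical in
theorem sum_kernel_collision (h : IsFlow t π p x) (m : ℝ) {i : ℕ} (hi : i < t) (v v' : α) :
    ∑ u, ∑ u', K i v u * K i v' u' * (if v = v' ∧ u = u' then (m * x i v u)⁻¹ else 0) =
      if v = v' then (m * p (π i) v)⁻¹ else 0 := by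
  split_ifs with hv
  · subst hv
    simp only [true_and, mul_ite, mul_zero, Finset.sum_ite_eq, Finset.mem_univ, if_true]
    by_cases h0 : p (π i) v = 0
    · simp [h.x_eq_zero hi h0, h0]
    · have : ∀ u, K i v u * K i v u * (m * x i v u)⁻¹ = K i v u * (m * p (π i) v)⁻¹ := by
        intro u
        rw [← h.p_mul_kernel hi v u]
        by_cases hK : K i v u = 0
        · simp [hK]
        · field_simp
      simp only [this]
      rw [← Finset.sum_mul, h.sum_kernel hi, one_mul]
  · simp [hv]

theorem collision_nonneg (h : IsFlow t π p x) {m : ℝ} (hm : 0 ≤ m) (i : ℕ) (C C' : ℕ → α) :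
    0 ≤ collision π x m i C C' := by
  unfold collision
  have := h.x_nonneg i (C (π i)) (C (i + 1))
  split_ifs <;> positivity

open Classical in
theorem collision_last (h : IsFlow t π p x) (m : ℝ) {k : ℕ} (c c' : Growth α k) (u u' : α) :
    collision π x m k (coord (k + 1) (c, u)) (coord (k + 1) (c', u')) =
      if coord k c (π k) = coord k c' (π k) ∧ u = u' then (m * x k (coord k c (π k)) u)⁻¹ else 0 := by
  simp only [collision, coord_succ_last, coord_succ_of_le (h.parent_le k)]

theorem collision_of_lt (h : IsFlow t π p x) (m : ℝ) {k i : ℕ} (hi : i < k) (c c' : Growth α k)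
    (u u' : α) :
    collision π x m i (coord (k + 1) (c, u)) (coord (k + 1) (c', u')) =
      collision π x m i (coord k c) (coord k c') := by
  have := h.parent_le i
  unfold collision
  rw [coord_succ_of_le (show i + 1 ≤ k by omega), coord_succ_of_le (show i + 1 ≤ k by omega),
    coord_succ_of_le (show π i ≤ k by omega), coord_succ_of_le (show π i ≤ k by omega)]

/-- The second process sits at the first one's parent vertex `v` with mass `p v`, which cancels the
collision reward `1 / (m p v)` and leaves `1 / m` for each unit of weight of the first. -/
theorem sum_pair_collision_le (h : IsFlow t π p x) {m : ℝ} (hm : 0 < m) {k : ℕ} (hk : k < t) :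
    ∑ c, ∑ c', ω (k + 1) c * ω (k + 1) c' *
      collision π x m k (coord (k + 1) c) (coord (k + 1) c') ≤ (∑ v, p 0 v) / m := by
  classical
  have e : ∀ c c' : Growth α k, ∑ u, ∑ u', ω k c * K k (coord k c (π k)) u *
      (ω k c' * K k (coord k c' (π k)) u') *
      (if coord k c (π k) = coord k c' (π k) ∧ u = u'
        then (m * x k (coord k c (π k)) u)⁻¹ else 0) =
      ω k c * (ω k c' * if coord k c' (π k) = coord k c (π k)
        then (m * p (π k) (coord k c (π k)))⁻¹ else 0) := by
    intro c c'
    have := h.sum_kernel_collision m hk (coord k c (π k)) (coord k c' (π k))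
    simp only [eq_comm (a := coord k c' (π k))]
    rw [← this, ← mul_assoc, Finset.mul_sum]
    refine Finset.sum_congr rfl fun u _ => ?_
    rw [Finset.mul_sum]
    refine Finset.sum_congr rfl fun u' _ => ?_
    ring
  rw [sum_succ]
  simp only [sum_succ, h.collision_last, Growth.weight]
  calc _ = ∑ c : Growth α k, ∑ c' : Growth α k, ω k c * (ω k c' *
        if coord k c' (π k) = coord k c (π k)
        then (m * p (π k) (coord k c (π k)))⁻¹ else 0) := by
        refine Finset.sum_congr rfl fun c _ => ?_
        rw [Finset.sum_comm]
        exact Finset.sum_congr rfl fun c' _ => e c c'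
    _ ≤ ∑ c : Growth α k, ω k c * m⁻¹ := by
        refine Finset.sum_le_sum fun c _ => ?_
        rw [← Finset.mul_sum, h.sum_weight_coord k hk.le (π k) (h.parent_le k)
          (fun v => if v = coord k c (π k) then (m * p (π k) (coord k c (π k)))⁻¹ else 0)]
        refine mul_le_mul_of_nonneg_left ?_ (h.weight_nonneg _ _)
        simp only [mul_ite, mul_zero, Finset.sum_ite_eq', Finset.mem_univ, if_true]
        rw [mul_inv, mul_left_comm]
        exact mul_le_of_le_one_right (by positivity) mul_inv_le_one
    _ = _ := by rw [← Finset.sum_mul, h.sum_weight hk.le, div_eq_mul_inv]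

/-- Conditionally on the past `(c, c')`, the new edge contributes `1` plus an expected reward of at
most `θ`; here the lower bound on vertex masses enters. -/
theorem sum_pair_step_le (h : IsFlow t π p x) {m θ : ℝ} {k : ℕ}
    (hk : k < t) (hθ : 0 ≤ θ) (hp : ∀ v, (m * p (π k) v)⁻¹ ≤ θ) (Φ : Growth α k → Growth α k → ℝ)
    (hΦ : ∀ c c', 0 ≤ Φ c c') :
    ∑ c, ∑ c', ω (k + 1) c * ω (k + 1) c' *
      (Φ c.1 c'.1 * (1 + collision π x m k (coord (k + 1) c) (coord (k + 1) c'))) ≤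
    (1 + θ) * ∑ c, ∑ c', ω k c * ω k c' * Φ c c' := by
  classical
  have e : ∀ c c' : Growth α k, ∑ u, ∑ u', ω k c * K k (coord k c (π k)) u *
      (ω k c' * K k (coord k c' (π k)) u') *
      (Φ c c' * (1 + if coord k c (π k) = coord k c' (π k) ∧ u = u'
        then (m * x k (coord k c (π k)) u)⁻¹ else 0)) ≤
      (1 + θ) * (ω k c * ω k c' * Φ c c') := by
    intro c c'
    have h1 := h.sum_kernel_collision m hk (coord k c (π k)) (coord k c' (π k))
    have h2 : ∑ u, ∑ u', K k (coord k c (π k)) u * K k (coord k c' (π k)) u' = 1 := by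
      simp only [← Finset.mul_sum, h.sum_kernel hk, mul_one]
    have h3 : (if coord k c (π k) = coord k c' (π k)
        then (m * p (π k) (coord k c (π k)))⁻¹ else 0) ≤ θ := by
      split_ifs
      · exact hp _
      · exact hθ
    have h4 : 0 ≤ ω k c * ω k c' * Φ c c' :=
      mul_nonneg (mul_nonneg (h.weight_nonneg _ _) (h.weight_nonneg _ _)) (hΦ _ _)
    calc _ = ω k c * ω k c' * Φ c c' *
          (∑ u, ∑ u', K k (coord k c (π k)) u * K k (coord k c' (π k)) u' +
          ∑ u, ∑ u', K k (coord k c (π k)) u * K k (coord k c' (π k)) u' *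
            (if coord k c (π k) = coord k c' (π k) ∧ u = u'
            then (m * x k (coord k c (π k)) u)⁻¹ else 0)) := by
          simp only [← Finset.sum_add_distrib, Finset.mul_sum]
          refine Finset.sum_congr rfl fun u _ => Finset.sum_congr rfl fun u' _ => ?_
          ring
      _ ≤ _ := by
          rw [h1, h2, mul_comm]
          exact mul_le_mul_of_nonneg_right (by linarith) h4
  rw [sum_succ]
  simp only [sum_succ, h.collision_last, Growth.weight]
  rw [Finset.mul_sum]
  refine Finset.sum_le_sum fun c _ => ?_
  rw [Finset.sum_comm, Finset.mul_sum]
  exact Finset.sum_le_sum fun c' _ => e c c'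

/-- The second moment of the tree-indexed process, with every coincidence on the edge `i` rewarded
by `1 / (m x)`. -/
theorem sum_pair_prod_le (h : IsFlow t π p x) {m θ : ℝ} (hm : 0 < m) (hθ : 0 ≤ θ)
    (hp : ∀ j ≤ t, ∀ v, (m * p j v)⁻¹ ≤ θ) : ∀ k ≤ t,
    (1 + θ) * ((∑ c, ∑ c', ω k c * ω k c' *
      ∏ i ∈ Finset.range k, (1 + collision π x m i (coord k c) (coord k c'))) - (∑ v, p 0 v) ^ 2) ≤
      k * (1 + θ) ^ k * ((∑ v, p 0 v) / m) := by
  -- The factor `1 + θ` on the left avoids the truncated exponent `k - 1` at `k = 0`.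
  intro k
  induction k with
  | zero =>
    intro hk
    simp only [Finset.range_zero, Finset.prod_empty, mul_one, ← Finset.mul_sum, ← Finset.sum_mul,
      h.sum_weight hk]
    simp [pow_two]
  | succ k ih =>
    intro hk
    specialize ih (by omega)
    set W := ∑ v, p 0 v with hW
    have hW0 : 0 ≤ W := Finset.sum_nonneg fun v _ => h.p_nonneg 0 v
    set P : Growth α k → Growth α k → ℝ := fun c c' =>
      ∏ i ∈ Finset.range k, (1 + collision π x m i (coord k c) (coord k c')) with hP
    have hP1 : ∀ c c', 0 ≤ P c c' - 1 := fun c c' =>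
      sub_nonneg.2 (Finset.one_le_prod fun i _ => by
        linarith [h.collision_nonneg hm.le i (coord k c) (coord k c')])
    have hstep := h.sum_pair_step_le (m := m) (show k < t by omega) hθ
      (hp _ (by have := h.parent_le k; omega)) (fun c c' => P c c' - 1) hP1
    have hcol := h.sum_pair_collision_le hm (show k < t by omega)
    have hone : ∀ l ≤ t, ∑ c, ∑ c', ω l c * ω l c' = W ^ 2 := by
      intro l hl
      simp only [← Finset.mul_sum, ← Finset.sum_mul, h.sum_weight hl, pow_two, hW]
    -- Writing `P (1 + κ) = (P - 1) (1 + κ) + κ + 1` gives the recursion `Δ (k + 1) ≤ (1 + θ) Δ k +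
    -- W / m` for the excess `Δ` of the second moment over `W ^ 2`.
    have hprod : ∀ c c' : Growth α (k + 1), ∏ i ∈ Finset.range (k + 1),
        (1 + collision π x m i (coord (k + 1) c) (coord (k + 1) c')) =
        (P c.1 c'.1 - 1) * (1 + collision π x m k (coord (k + 1) c) (coord (k + 1) c')) +
        collision π x m k (coord (k + 1) c) (coord (k + 1) c') + 1 := by
      rintro ⟨c, u⟩ ⟨c', u'⟩
      rw [Finset.prod_range_succ]
      have : ∏ i ∈ Finset.range k, (1 + collision π x m i (coord (k + 1) (c, u))
          (coord (k + 1) (c', u'))) = P c c' :=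
        Finset.prod_congr rfl fun i hi => by
          rw [h.collision_of_lt m (Finset.mem_range.1 hi)]
      rw [this]
      ring
    have hsum : (∑ c, ∑ c', ω (k + 1) c * ω (k + 1) c' * ∏ i ∈ Finset.range (k + 1),
        (1 + collision π x m i (coord (k + 1) c) (coord (k + 1) c'))) - W ^ 2 =
        ∑ c, ∑ c', ω (k + 1) c * ω (k + 1) c' * ((P c.1 c'.1 - 1) *
          (1 + collision π x m k (coord (k + 1) c) (coord (k + 1) c'))) +
        ∑ c, ∑ c', ω (k + 1) c * ω (k + 1) c' *
          collision π x m k (coord (k + 1) c) (coord (k + 1) c') := by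
      simp only [hprod, mul_add, mul_one, Finset.sum_add_distrib, hone _ hk]
      ring
    have hprev : ∑ c, ∑ c', ω k c * ω k c' * (P c c' - 1) =
        (∑ c, ∑ c', ω k c * ω k c' * P c c') - W ^ 2 := by
      simp only [mul_sub, mul_one, Finset.sum_sub_distrib, hone _ (show k ≤ t by omega)]
    rw [hsum]
    rw [hprev] at hstep
    have h1 : (1 : ℝ) ≤ (1 + θ) ^ k := one_le_pow₀ (by linarith)
    have hWm : 0 ≤ W / m := by positivity
    push_cast
    calc _ ≤ (1 + θ) * (k * (1 + θ) ^ k * (W / m) + W / m) := by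
          refine mul_le_mul_of_nonneg_left ?_ (by linarith)
          linarith
      _ ≤ (1 + θ) * (k * (1 + θ) ^ k * (W / m) + (1 + θ) ^ k * (W / m)) := by
          refine mul_le_mul_of_nonneg_left ?_ (by linarith)
          nlinarith
      _ = _ := by ring

end IsFlow

end EdgeTesting

/-! ### Second-moment method for independent samples -/

namespace EdgeTesting

section Moments

variable {Λ κ : Type*} [DecidableEq κ]

/-- The number of entries of `y` with label `k`. -/
def labelCount {m : ℕ} (ℓ : Λ → κ) (y : Fin m → Λ) (k : κ) : ℝ :=
  ∑ j, if ℓ (y j) = k then 1 else 0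

theorem labelCount_nonneg {m : ℕ} (ℓ : Λ → κ) (y : Fin m → Λ) (k : κ) : 0 ≤ labelCount ℓ y k :=
  Finset.sum_nonneg fun _ _ => by split_ifs <;> norm_num

theorem exists_of_labelCount_ne_zero {m : ℕ} {ℓ : Λ → κ} {y : Fin m → Λ} {k : κ}
    (h : labelCount ℓ y k ≠ 0) : ∃ j, ℓ (y j) = k := by
  by_contra! hn
  exact h (Finset.sum_eq_zero fun j _ => if_neg (hn j))

variable [Fintype Λ]

/-- The mass of the fibre of `ℓ` over `k`. -/
def fibreMass (μ : Λ → ℝ) (ℓ : Λ → κ) (k : κ) : ℝ := ∑ e, μ e * if ℓ e = k then 1 else 0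

theorem sum_prod_mul_prod {J : Type*} [Fintype J] [DecidableEq J] (μ : Λ → ℝ)
    (g : J → Λ → ℝ) :
    ∑ y : J → Λ, (∏ j, μ (y j)) * ∏ j, g j (y j) = ∏ j, ∑ e, μ e * g j e := by
  simp only [← Finset.prod_mul_distrib]
  rw [Finset.prod_univ_sum, Fintype.piFinset_univ]

theorem sum_prod_eq_one {J : Type*} [Fintype J] [DecidableEq J] {μ : Λ → ℝ} (h1 : ∑ e, μ e = 1) :
    ∑ y : J → Λ, ∏ j, μ (y j) = 1 := by
  simpa [h1] using sum_prod_mul_prod (J := J) μ (fun _ _ => 1)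

theorem sum_prod_mul_single {m : ℕ} {μ : Λ → ℝ} (h1 : ∑ e, μ e = 1) (j₀ : Fin m) (g : Λ → ℝ) :
    ∑ y : Fin m → Λ, (∏ j, μ (y j)) * g (y j₀) = ∑ e, μ e * g e := by
  have := sum_prod_mul_prod (J := Fin m) μ (fun j e => if j = j₀ then g e else 1)
  simp only [Finset.prod_ite_eq', Finset.mem_univ, if_true] at this
  rw [this]
  have e : ∀ j : Fin m, ∑ e, μ e * (if j = j₀ then g e else 1) =
      if j = j₀ then ∑ e, μ e * g e else 1 := by
    intro j
    split_ifs <;> simp [h1]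
  simp only [e, Finset.prod_ite_eq', Finset.mem_univ, if_true]

theorem sum_prod_mul_pair {m : ℕ} {μ : Λ → ℝ} (h1 : ∑ e, μ e = 1) {j₁ j₂ : Fin m} (hj : j₁ ≠ j₂)
    (g g' : Λ → ℝ) :
    ∑ y : Fin m → Λ, (∏ j, μ (y j)) * (g (y j₁) * g' (y j₂)) =
      (∑ e, μ e * g e) * ∑ e, μ e * g' e := by
  have := sum_prod_mul_prod (J := Fin m) μ
    (fun j e => (if j = j₁ then g e else 1) * (if j = j₂ then g' e else 1))
  simp only [Finset.prod_mul_distrib, Finset.prod_ite_eq', Finset.mem_univ, if_true] at this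
  rw [this]
  have e : ∀ j : Fin m, ∑ e, μ e * ((if j = j₁ then g e else 1) * (if j = j₂ then g' e else 1)) =
      (if j = j₁ then ∑ e, μ e * g e else 1) * (if j = j₂ then ∑ e, μ e * g' e else 1) := by
    intro j
    split_ifs with h2 h3
    · exact absurd (h2.symm.trans h3) hj
    all_goals simp [h1]
  simp only [e, Finset.prod_mul_distrib, Finset.prod_ite_eq', Finset.mem_univ, if_true]

theorem fibreMass_nonneg {μ : Λ → ℝ} (h0 : ∀ e, 0 ≤ μ e) (ℓ : Λ → κ) (k : κ) :
    0 ≤ fibreMass μ ℓ k :=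
  Finset.sum_nonneg fun e _ => mul_nonneg (h0 e) (by split_ifs <;> norm_num)

theorem sum_prod_mul_labelCount {m : ℕ} {μ : Λ → ℝ} (h1 : ∑ e, μ e = 1) (ℓ : Λ → κ) (k : κ) :
    ∑ y : Fin m → Λ, (∏ j, μ (y j)) * labelCount ℓ y k = m * fibreMass μ ℓ k := by
  simp only [labelCount, Finset.mul_sum]
  rw [Finset.sum_comm]
  simp only [sum_prod_mul_single h1 _ (fun e => if ℓ e = k then (1 : ℝ) else 0)]
  simp [fibreMass]

/-- Pairs of distinct sample indices factor into `q q'`; a repeated index contributes only when the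
labels agree. Granting `q q'` to the diagonal pairs as well is what makes this an inequality. -/
theorem sum_prod_mul_labelCount_mul_le {m : ℕ} {μ : Λ → ℝ} (h0 : ∀ e, 0 ≤ μ e)
    (h1 : ∑ e, μ e = 1) (ℓ : Λ → κ) (k k' : κ) :
    ∑ y : Fin m → Λ, (∏ j, μ (y j)) * (labelCount ℓ y k * labelCount ℓ y k') ≤
      (m * fibreMass μ ℓ k) * (m * fibreMass μ ℓ k') +
        if k = k' then m * fibreMass μ ℓ k else 0 := by
  have hq := fibreMass_nonneg h0 ℓ
  have e1 : ∑ y : Fin m → Λ, (∏ j, μ (y j)) * (labelCount ℓ y k * labelCount ℓ y k') =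
      ∑ j₁ : Fin m, ∑ j₂ : Fin m, ∑ y : Fin m → Λ, (∏ j, μ (y j)) *
        ((if ℓ (y j₁) = k then (1 : ℝ) else 0) * (if ℓ (y j₂) = k' then 1 else 0)) := by
    simp only [labelCount, Finset.sum_mul_sum]
    simp only [Finset.mul_sum]
    rw [Finset.sum_comm]
    exact Finset.sum_congr rfl fun j₁ _ => Finset.sum_comm
  rw [e1]
  calc _ ≤ ∑ j₁ : Fin m, ∑ j₂ : Fin m, (fibreMass μ ℓ k * fibreMass μ ℓ k' +
        if j₁ = j₂ then (if k = k' then fibreMass μ ℓ k else 0) else 0) := by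
        refine Finset.sum_le_sum fun j₁ _ => Finset.sum_le_sum fun j₂ _ => ?_
        by_cases hj : j₁ = j₂
        · subst hj
          rw [sum_prod_mul_single h1 j₁
            (fun e => (if ℓ e = k then (1 : ℝ) else 0) * (if ℓ e = k' then 1 else 0)), if_pos rfl]
          have := mul_nonneg (hq k) (hq k')
          by_cases hk : k = k'
          · subst hk
            rw [if_pos rfl]
            refine le_trans (le_of_eq ?_) (le_add_of_nonneg_left this)
            refine Finset.sum_congr rfl fun e _ => ?_
            split_ifs <;> simp
          · rw [if_neg hk, add_zero]
            refine le_trans (le_of_eq ?_) this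
            refine Finset.sum_eq_zero fun e _ => ?_
            by_cases h : ℓ e = k
            · simp [h, hk]
            · simp [h]
        · rw [sum_prod_mul_pair h1 hj (fun e => if ℓ e = k then (1 : ℝ) else 0)
            (fun e => if ℓ e = k' then 1 else 0), if_neg hj, add_zero]
          rfl
    _ = _ := by
        simp only [Finset.sum_add_distrib, Finset.sum_ite_eq, Finset.mem_univ, if_true,
          Finset.sum_const, Finset.card_univ, Fintype.card_fin, nsmul_eq_mul]
        split_ifs <;> ring

/-- `y` contains, for some `c` of nonzero weight, a sample with label `a c i` in every block `i`. -/
def Covers {ι : Type*} {t m : ℕ} (ω : ι → ℝ) (a : ι → Fin t → κ) (ℓ : Λ → κ)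
    (y : Fin t → Fin m → Λ) : Prop :=
  ∃ c, ω c ≠ 0 ∧ ∀ i, ∃ j, ℓ (y i j) = a c i

open Classical in
/-- Chebyshev's inequality for the weighted number of configurations that are covered by `t`
independent blocks of `m` samples. -/
theorem sum_not_covers_le {ι : Type*} [Fintype ι] {t m : ℕ} (hm : 0 < m) {μ : Λ → ℝ}
    (h0 : ∀ e, 0 ≤ μ e) (h1 : ∑ e, μ e = 1) (ℓ : Λ → κ) (ω : ι → ℝ) (hω : ∀ c, 0 ≤ ω c)
    (a : ι → Fin t → κ) (hq : ∀ c, ω c ≠ 0 → ∀ i, 0 < fibreMass μ ℓ (a c i))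
    (D : ι → ι → Fin t → ℝ) (hD0 : ∀ c c' i, 0 ≤ D c c' i)
    (hD : ∀ c c', ω c ≠ 0 → ω c' ≠ 0 → ∀ i, a c i = a c' i →
      (m * fibreMass μ ℓ (a c i))⁻¹ ≤ D c c' i) :
    (∑ c, ω c) ^ 2 * ∑ y : Fin t → Fin m → Λ with ¬ Covers ω a ℓ y, ∏ i, ∏ j, μ (y i j) ≤
      (∑ c, ∑ c', ω c * ω c' * ∏ i, (1 + D c c' i)) - (∑ c, ω c) ^ 2 := by
  have hm' : (0 : ℝ) < m := by exact_mod_cast hm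
  set V := ∑ c, ω c with hV
  set ν : (Fin m → Λ) → ℝ := fun z => ∏ j, μ (z j) with hν
  have hν0 : ∀ z, 0 ≤ ν z := fun z => Finset.prod_nonneg fun _ _ => h0 _
  have hν1 : ∑ z, ν z = 1 := sum_prod_eq_one h1
  set Pr : (Fin t → Fin m → Λ) → ℝ := fun y => ∏ i, ν (y i) with hPr
  have hPr0 : ∀ y, 0 ≤ Pr y := fun y => Finset.prod_nonneg fun _ _ => hν0 _
  have hPr1 : ∑ y, Pr y = 1 := sum_prod_eq_one hν1
  -- Counts are normalised to mean `1`, so `X` has mean `V` and vanishes on uncovered outcomes.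
  set r : κ → (Fin m → Λ) → ℝ := fun k z => labelCount ℓ z k / (m * fibreMass μ ℓ k) with hr
  set X : (Fin t → Fin m → Λ) → ℝ := fun y => ∑ c, ω c * ∏ i, r (a c i) (y i) with hX
  have hEX : ∑ y, Pr y * X y = V := by
    simp only [hX, Finset.mul_sum]
    rw [Finset.sum_comm]
    refine Finset.sum_congr rfl fun c _ => ?_
    by_cases hc : ω c = 0
    · simp [hc]
    have : ∀ i, ∑ z, ν z * r (a c i) z = 1 := by
      intro i
      simp only [hr, ← mul_div_assoc]
      rw [← Finset.sum_div, sum_prod_mul_labelCount h1]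
      have := hq c hc i
      exact div_self (by positivity)
    have e := sum_prod_mul_prod (J := Fin t) ν (fun i => r (a c i))
    simp only [this, Finset.prod_const_one] at e
    calc _ = ω c * ∑ y : Fin t → Fin m → Λ, (∏ i, ν (y i)) * ∏ i, r (a c i) (y i) := by
          rw [Finset.mul_sum]
          exact Finset.sum_congr rfl fun y _ => by simp only [hPr]; ring
      _ = _ := by rw [e, mul_one]
  have hEX2 : ∑ y, Pr y * (X y) ^ 2 ≤ ∑ c, ∑ c', ω c * ω c' * ∏ i, (1 + D c c' i) := by
    have e : ∑ y, Pr y * (X y) ^ 2 = ∑ c, ∑ c', ∑ y,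
        ω c * ω c' * (Pr y * ∏ i, (r (a c i) (y i) * r (a c' i) (y i))) := by
      simp only [hX, pow_two, Finset.sum_mul_sum]
      simp only [Finset.mul_sum]
      rw [Finset.sum_comm]
      refine Finset.sum_congr rfl fun c _ => ?_
      rw [Finset.sum_comm]
      refine Finset.sum_congr rfl fun c' _ => Finset.sum_congr rfl fun y _ => ?_
      rw [Finset.prod_mul_distrib]
      ring
    rw [e]
    refine Finset.sum_le_sum fun c _ => Finset.sum_le_sum fun c' _ => ?_
    rw [← Finset.mul_sum]
    by_cases hc : ω c = 0
    · simp [hc]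
    by_cases hc' : ω c' = 0
    · simp [hc']
    refine mul_le_mul_of_nonneg_left ?_ (mul_nonneg (hω _) (hω _))
    have e' := sum_prod_mul_prod (J := Fin t) ν (fun i z => r (a c i) z * r (a c' i) z)
    simp only [hPr]
    rw [e']
    refine Finset.prod_le_prod (fun i _ => ?_) fun i _ => ?_
    · refine Finset.sum_nonneg fun z _ => mul_nonneg (hν0 z) (mul_nonneg ?_ ?_) <;>
      exact div_nonneg (labelCount_nonneg _ _ _)
        (mul_nonneg hm'.le (fibreMass_nonneg h0 _ _))
    · have hb := sum_prod_mul_labelCount_mul_le (m := m) h0 h1 ℓ (a c i) (a c' i)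
      have p1 := mul_pos hm' (hq c hc i)
      have p2 := mul_pos hm' (hq c' hc' i)
      have e2 : ∑ z, ν z * (r (a c i) z * r (a c' i) z) =
          (∑ z : Fin m → Λ, ν z * (labelCount ℓ z (a c i) * labelCount ℓ z (a c' i))) /
            ((m * fibreMass μ ℓ (a c i)) * (m * fibreMass μ ℓ (a c' i))) := by
        rw [Finset.sum_div]
        refine Finset.sum_congr rfl fun z _ => ?_
        simp only [hr]
        rw [div_mul_div_comm, ← mul_div_assoc]
      rw [e2, div_le_iff₀ (mul_pos p1 p2)]
      refine hb.trans ?_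
      -- Equal labels give a factor `1 + 1 / (m q)`, and distinct labels give at most `1`.
      by_cases hk : a c i = a c' i
      · have := hD c c' hc hc' i hk
        rw [if_pos hk, ← hk]
        rw [inv_le_iff_one_le_mul₀ p1] at this
        nlinarith
      · rw [if_neg hk]
        nlinarith [hD0 c c' i, mul_pos p1 p2]
  have hzero : ∀ y, ¬ Covers ω a ℓ y → X y = 0 := by
    intro y hy
    refine Finset.sum_eq_zero fun c _ => ?_
    by_contra hne
    refine hy ⟨c, left_ne_zero_of_mul hne, fun i => ?_⟩
    have := Finset.prod_ne_zero_iff.1 (right_ne_zero_of_mul hne) i (Finset.mem_univ _)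
    exact exists_of_labelCount_ne_zero (fun h => this (by simp [hr, h]))
  have hvar : ∑ y, Pr y * (X y - V) ^ 2 = (∑ y, Pr y * (X y) ^ 2) - V ^ 2 := by
    have : ∀ y, Pr y * (X y - V) ^ 2 = Pr y * (X y) ^ 2 - 2 * V * (Pr y * X y) + V ^ 2 * Pr y := by
      intro y; ring
    simp only [this, Finset.sum_add_distrib, Finset.sum_sub_distrib, ← Finset.mul_sum, hEX, hPr1]
    ring
  -- On uncovered outcomes `(X - V) ^ 2 = V ^ 2`, so `V ^ 2` times their probability is at most the
  -- variance.
  calc _ = ∑ y with ¬ Covers ω a ℓ y, Pr y * (X y - V) ^ 2 := by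
        rw [Finset.mul_sum]
        refine Finset.sum_congr rfl fun y hy => ?_
        rw [hzero y (Finset.mem_filter.1 hy).2]
        simp only [hPr, hν]
        ring
    _ ≤ ∑ y, Pr y * (X y - V) ^ 2 :=
        Finset.sum_le_sum_of_subset_of_nonneg (Finset.filter_subset _ _)
          fun y _ _ => mul_nonneg (hPr0 y) (sq_nonneg _)
    _ ≤ _ := by rw [hvar]; linarith

end Moments

end EdgeTesting

/-! ### Growth orders of trees and robust fractional packings -/

namespace EdgeTesting

/-- The vertices of a finite tree can be listed as `ν 0, …, ν t` such that every later vertex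
`ν (i + 1)` is joined to an earlier one `ν (π i)`, and these are all the edges. -/
theorem exists_growth_order {V : Type*} [Finite V] {H : SimpleGraph V} (hH : H.IsTree) {t : ℕ}
    (ht : H.edgeSet.ncard = t) :
    ∃ (ν : ℕ → V) (π : ℕ → ℕ), (∀ i, π i ≤ i) ∧ (∀ i ≤ t, ∀ j ≤ t, ν i = ν j → i = j) ∧
      (∀ v, ∃ j ≤ t, ν j = v) ∧ (∀ i < t, H.Adj (ν (π i)) (ν (i + 1))) ∧
      ∀ a b, H.Adj a b → ∃ i < t, s(a, b) = s(ν (π i), ν (i + 1)) := by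
  classical
  have := Fintype.ofFinite V
  have hcardE : H.edgeFinset.card = t := by
    rw [← ht, ← SimpleGraph.coe_edgeFinset, Set.ncard_coe_finset]
  have hcard : Fintype.card V = t + 1 := by rw [← hH.card_edgeFinset, hcardE]
  obtain ⟨r⟩ := hH.connected.nonempty
  have grow : ∀ k ≤ t, ∃ (ν : ℕ → V) (π : ℕ → ℕ), (∀ i, π i ≤ i) ∧
      (∀ i ≤ k, ∀ j ≤ k, ν i = ν j → i = j) ∧ ∀ i < k, H.Adj (ν (π i)) (ν (i + 1)) := by
    intro k
    induction k with
    | zero => exact fun _ => ⟨fun _ => r, id, fun _ => le_rfl, by intros; omega, by intros; omega⟩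
    | succ k ih =>
      intro hk
      obtain ⟨ν, π, hπ, hinj, hadj⟩ := ih (by omega)
      obtain ⟨v, hv⟩ : ∃ v, v ∉ (Finset.range (k + 1)).image ν := by
        by_contra! hall
        have := Finset.card_le_card (fun v _ => hall v : (Finset.univ : Finset V) ⊆ _)
        have := this.trans Finset.card_image_le
        rw [Finset.card_univ, Finset.card_range] at this
        omega
      -- A walk from a listed vertex to an unlisted one leaves the listed set along some edge, which
      -- supplies the next vertex and its parent.
      obtain ⟨p⟩ := hH.connected.preconnected (ν 0) v
      obtain ⟨d, _, hd1, hd2⟩ := p.exists_boundary_dart ((Finset.range (k + 1)).image ν : Finset V)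
        (by simpa using ⟨0, by omega, rfl⟩) (by simpa using hv)
      obtain ⟨a, ha, ha'⟩ := Finset.mem_image.1 (Finset.mem_coe.1 hd1)
      have ha : a ≤ k := by have := Finset.mem_range.1 ha; omega
      have hnew : ∀ j ≤ k, ν j ≠ d.snd := fun j hj he =>
        hd2 (Finset.mem_coe.2 (Finset.mem_image.2 ⟨j, Finset.mem_range.2 (by omega), he⟩))
      refine ⟨Function.update ν (k + 1) d.snd, Function.update π k a, ?_, ?_, ?_⟩
      · intro i
        by_cases hi : i = k
        · subst hi; simpa using ha
        · simpa [Function.update_of_ne hi] using hπ i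
      · intro i hi j hj he
        by_cases hi' : i = k + 1 <;> by_cases hj' : j = k + 1
        · omega
        · subst hi'
          rw [Function.update_self, Function.update_of_ne hj'] at he
          exact absurd he.symm (hnew j (by omega))
        · subst hj'
          rw [Function.update_self, Function.update_of_ne hi'] at he
          exact absurd he (hnew i (by omega))
        · rw [Function.update_of_ne hi', Function.update_of_ne hj'] at he
          exact hinj i (by omega) j (by omega) he
      · intro i hi
        by_cases hi' : i = k
        · subst hi'
          rw [Function.update_self, Function.update_self, Function.update_of_ne (by omega), ha']
          exact d.adj
        · have := hπ i
          rw [Function.update_of_ne hi', Function.update_of_ne (by omega),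
            Function.update_of_ne (by omega)]
          exact hadj i (by omega)
  obtain ⟨ν, π, hπ, hinj, hadj⟩ := grow t le_rfl
  refine ⟨ν, π, hπ, hinj, ?_, hadj, ?_⟩
  · have himg : (Finset.range (t + 1)).image ν = Finset.univ := by
      refine Finset.eq_univ_of_card _ ?_
      rw [Finset.card_image_of_injOn, Finset.card_range, hcard]
      intro i hi j hj he
      simp only [Finset.coe_range, Set.mem_Iio] at hi hj
      exact hinj i (by omega) j (by omega) he
    intro v
    obtain ⟨j, hj, he⟩ := Finset.mem_image.1 (himg ▸ Finset.mem_univ v)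
    exact ⟨j, by have := Finset.mem_range.1 hj; omega, he⟩
  -- The newest endpoint separates an edge from all earlier ones, so these are `t` distinct edges,
  -- hence all of them.
  · have key : ∀ i < t, ∀ j < t, i < j → s(ν (π i), ν (i + 1)) ≠ s(ν (π j), ν (j + 1)) := by
      intro i hi j hj hij he
      have hm : ν (j + 1) ∈ s(ν (π i), ν (i + 1)) := he ▸ Sym2.mem_mk_right _ _
      have := hπ i
      rcases Sym2.mem_iff.1 hm with h | h
      · have := hinj _ (by omega) _ (by omega) h; omega
      · have := hinj _ (by omega) _ (by omega) h; omega
    have himg : (Finset.range t).image (fun i => s(ν (π i), ν (i + 1))) = H.edgeFinset := by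
      refine Finset.eq_of_subset_of_card_le ?_ ?_
      · intro e he
        obtain ⟨i, hi, rfl⟩ := Finset.mem_image.1 he
        exact SimpleGraph.mem_edgeFinset.2 (hadj i (Finset.mem_range.1 hi))
      · rw [Finset.card_image_of_injOn, Finset.card_range, hcardE]
        intro i hi j hj he
        simp only [Finset.coe_range, Set.mem_Iio] at hi hj
        rcases lt_trichotomy i j with h | h | h
        · exact absurd he (key i hi j hj h)
        · exact h
        · exact absurd he.symm (key j hj i hi h)
    intro a b hab
    have : s(a, b) ∈ (Finset.range t).image (fun i => s(ν (π i), ν (i + 1))) := by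
      rw [himg]
      exact SimpleGraph.mem_edgeFinset.2 hab
    obtain ⟨i, hi, he⟩ := Finset.mem_image.1 this
    exact ⟨i, Finset.mem_range.1 hi, he.symm⟩

/-- A greedy fractional packing saturates an element of every member of the family. -/
theorem exists_saturating_packing {ι κ : Type*} [DecidableEq ι] [DecidableEq κ] (E : ι → Finset κ)
    (hE : ∀ c, (E c).Nonempty) (q : κ → ℝ) (hq : ∀ k, 0 ≤ q k) (S : Finset ι) :
    ∃ w : ι → ℝ, (∀ c, 0 ≤ w c) ∧ (∀ c, c ∉ S → w c = 0) ∧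
      (∀ k, (∑ c ∈ S, if k ∈ E c then w c else 0) ≤ q k) ∧
      ∀ c ∈ S, ∃ k ∈ E c, (∑ c ∈ S, if k ∈ E c then w c else 0) = q k := by
  induction S using Finset.induction_on with
  | empty => exact ⟨0, by simp, by simp, by simpa using hq, by simp⟩
  | insert c₀ S hc₀ ih =>
    obtain ⟨w, hw0, hwS, hle, hsat⟩ := ih
    set L : κ → ℝ := fun k => ∑ c ∈ S, if k ∈ E c then w c else 0 with hL
    -- The new member takes the smallest residual capacity on its elements. This saturates `k₀`, and
    -- it is zero if the member meets an already saturated element, so saturation persists.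
    obtain ⟨k₀, hk₀, hmin⟩ := Finset.exists_min_image (E c₀) (fun k => q k - L k) (hE c₀)
    have hδ : 0 ≤ q k₀ - L k₀ := sub_nonneg.2 (hle k₀)
    have hload : ∀ k, (∑ c ∈ insert c₀ S,
        if k ∈ E c then Function.update w c₀ (q k₀ - L k₀) c else 0) =
        (if k ∈ E c₀ then q k₀ - L k₀ else 0) + L k := by
      intro k
      rw [Finset.sum_insert hc₀, Function.update_self]
      congr 1
      refine Finset.sum_congr rfl fun c hc => ?_
      rw [Function.update_of_ne (ne_of_mem_of_not_mem hc hc₀)]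
    refine ⟨Function.update w c₀ (q k₀ - L k₀), ?_, ?_, ?_, ?_⟩
    · intro c
      by_cases h : c = c₀
      · subst h; simpa using hle k₀
      · rw [Function.update_of_ne h]; exact hw0 c
    · intro c hc
      rw [Finset.mem_insert, not_or] at hc
      rw [Function.update_of_ne hc.1]
      exact hwS c hc.2
    · intro k
      rw [hload]
      split_ifs with h
      · have := hmin k h; linarith
      · simpa using hle k
    · intro c hc
      rcases Finset.mem_insert.1 hc with rfl | hc
      · exact ⟨k₀, hk₀, by rw [hload, if_pos hk₀]; ring⟩
      · obtain ⟨k, hk, he⟩ := hsat c hc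
        refine ⟨k, hk, ?_⟩
        rw [hload]
        split_ifs with h
        · have := hmin k h
          have h2 : L k = q k := he
          linarith
        · simpa using he

/-- `c` is an embedding of `H` as a subgraph of `G`. -/
def IsCopy {V α : Type*} (H : SimpleGraph V) (G : SimpleGraph α) (c : V → α) : Prop :=
  Function.Injective c ∧ ∀ a b, H.Adj a b → G.Adj (c a) (c b)

theorem IsCopy.isContained {V α : Type*} {H : SimpleGraph V} {G : SimpleGraph α} {c : V → α}
    (h : IsCopy H G c) : H.IsContained G :=
  ⟨⟨⟨c, fun {a b} hab => h.2 a b hab⟩, h.1⟩⟩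

theorem exists_isCopy {V α : Type*} {H : SimpleGraph V} {G : SimpleGraph α}
    (h : H.IsContained G) : ∃ c, IsCopy H G c := by
  obtain ⟨φ⟩ := h
  exact ⟨φ, φ.injective, fun a b hab => φ.toHom.map_adj hab⟩

theorem toGraph_adj {n : ℕ} {f : Edge n → Bool} {a b : Fin n} :
    (toGraph f).Adj a b ↔ ∃ e : Edge n, e.val = s(a, b) ∧ f e = true := by
  unfold toGraph
  rw [SimpleGraph.fromEdgeSet_adj]
  constructor
  · rintro ⟨⟨h, hf⟩, _⟩
    exact ⟨_, rfl, hf⟩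
  · rintro ⟨⟨e, he⟩, rfl, hf⟩
    exact ⟨⟨he, hf⟩, by simpa using he⟩

open Classical in
/-- A function that is far from `H`-freeness admits a heavy fractional packing of copies of `H`. -/
theorem exists_packing_of_far {V : Type*} [Fintype V] {H : SimpleGraph V} {t n : ℕ}
    (ht : 1 ≤ t) (hE : H.edgeFinset.card = t) {μ : Edge n → ℝ} (h0 : ∀ e, 0 ≤ μ e)
    {f : Edge n → Bool} {ε : ℝ} (hfar : ∀ g ∈ freeProperty H n, ε ≤ dist μ f g) :
    ∃ w : (V → Fin n) → ℝ, (∀ c, 0 ≤ w c) ∧ (∀ c, w c ≠ 0 → IsCopy H (toGraph f) c) ∧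
      (∀ k, (∑ c, if k ∈ H.edgeFinset.image (Sym2.map c) then w c else 0) ≤
        fibreMass μ Subtype.val k) ∧ ε ≤ t * ∑ c, w c := by
  set E : (V → Fin n) → Finset (Sym2 (Fin n)) := fun c => H.edgeFinset.image (Sym2.map c) with hEdef
  have hEne : ∀ c, (E c).Nonempty := fun c =>
    Finset.Nonempty.image (Finset.card_pos.1 (by omega)) _
  obtain ⟨w, hw0, hwS, hle, hsat⟩ := exists_saturating_packing E hEne
    (fibreMass μ Subtype.val) (fibreMass_nonneg h0 _)
    (Finset.univ.filter fun c => IsCopy H (toGraph f) c)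
  have hsum : ∀ k, (∑ c with IsCopy H (toGraph f) c, if k ∈ E c then w c else 0) =
      ∑ c, if k ∈ E c then w c else 0 := by
    intro k
    refine Finset.sum_subset (Finset.filter_subset _ _) fun c _ hc => ?_
    rw [hwS c hc, ite_self]
  simp only [hsum] at hle hsat
  refine ⟨w, hw0, fun c hc => ?_, hle, ?_⟩
  · by_contra hn
    exact hc (hwS c (by simpa using hn))
  set D : Finset (Sym2 (Fin n)) := Finset.univ.filter fun k =>
    (∑ c, if k ∈ E c then w c else 0) = fibreMass μ Subtype.val k with hD
  -- Every copy in `f` contains a saturated edge, so erasing those edges gives an `H`-free graph and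
  -- their mass is at least `ε`. Each copy loads at most `t` edges, whence the factor `t`.
  set g : Edge n → Bool := fun e => f e && decide (e.val ∉ D) with hg
  have hgP : g ∈ freeProperty H n := by
    intro hcon
    obtain ⟨c, hc⟩ := exists_isCopy hcon
    have hc' : IsCopy H (toGraph f) c := by
      refine ⟨hc.1, fun a b hab => ?_⟩
      obtain ⟨e, he, hge⟩ := toGraph_adj.1 (hc.2 a b hab)
      exact toGraph_adj.2 ⟨e, he, by simp only [hg, Bool.and_eq_true] at hge; exact hge.1⟩
    obtain ⟨k, hk, hkq⟩ := hsat c (by simpa using hc')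
    obtain ⟨d, hd, rfl⟩ := Finset.mem_image.1 hk
    induction d with
    | _ a b =>
      obtain ⟨e, he, hge⟩ := toGraph_adj.1 (hc.2 a b (SimpleGraph.mem_edgeFinset.1 hd))
      simp only [hg, Bool.and_eq_true, decide_eq_true_eq] at hge
      refine hge.2 ?_
      rw [hD, Finset.mem_filter]
      refine ⟨Finset.mem_univ _, ?_⟩
      rw [he]
      exact hkq
  have hcardE : ∀ c, ((E c).card : ℝ) ≤ t := fun c => by
    exact_mod_cast hE ▸ Finset.card_image_le
  calc ε ≤ dist μ f g := hfar g hgP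
    _ ≤ ∑ e, μ e * (if e.val ∈ D then 1 else 0) := by
        unfold dist
        rw [Finset.sum_filter]
        refine Finset.sum_le_sum fun e _ => ?_
        split_ifs with h1 h2 h2
        · simp
        · exact absurd (by simp [hg, h2]) h1
        · simpa using h0 e
        · simp
    _ = ∑ k ∈ D, fibreMass μ Subtype.val k := by
        unfold fibreMass
        rw [Finset.sum_comm]
        refine Finset.sum_congr rfl fun e _ => ?_
        rw [← Finset.mul_sum, Finset.sum_ite_eq]
    _ = ∑ k ∈ D, ∑ c, if k ∈ E c then w c else 0 :=
        Finset.sum_congr rfl fun k hk => (Finset.mem_filter.1 hk).2.symm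
    _ ≤ ∑ k, ∑ c, if k ∈ E c then w c else 0 :=
        Finset.sum_le_sum_of_subset_of_nonneg (Finset.subset_univ _) fun k _ _ =>
          Finset.sum_nonneg fun c _ => by split_ifs; exacts [hw0 c, le_rfl]
    _ = ∑ c, (E c).card * w c := by
        rw [Finset.sum_comm]
        refine Finset.sum_congr rfl fun c _ => ?_
        rw [← Finset.sum_filter, Finset.sum_const, nsmul_eq_mul, Finset.filter_univ_mem]
    _ ≤ ∑ c, t * w c :=
        Finset.sum_le_sum fun c _ => mul_le_mul_of_nonneg_right (hcardE c) (hw0 c)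
    _ = _ := by rw [Finset.mul_sum]

open Classical in
/-- Some colouring of the host vertices retains a constant fraction of the weight on colourful
copies. -/
theorem exists_colouring {V α : Type*} [Fintype V] [Fintype α] [Nonempty V]
    (w : (V → α) → ℝ) (hw0 : ∀ c, 0 ≤ w c) (hw : ∀ c, w c ≠ 0 → Function.Injective c) :
    ∃ χ : α → V, ∑ c, w c ≤
      (Fintype.card V : ℝ) ^ Fintype.card V * ∑ c with ∀ h, χ (c h) = h, w c := by
  have hcount : ∀ c : V → α, Function.Injective c → (Fintype.card V : ℝ) ^ Fintype.card α ≤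
      (Fintype.card V : ℝ) ^ Fintype.card V *
        ((Finset.univ.filter fun χ : α → V => ∀ h, χ (c h) = h).card : ℝ) := by
    intro c hc
    -- A colouring is recovered from its restriction to the image of `c` together with the colouring
    -- overwritten there so as to respect `c`. So a fraction at least `|V| ^ (-|V|)` of all
    -- colourings respects `c`, and averaging applies.
    have hinj : Function.Injective (fun χ : α → V =>
        ((⟨fun a => if h : ∃ v, c v = a then h.choose else χ a, by
          intro h
          have hex : ∃ v, c v = c h := ⟨h, rfl⟩
          refine (dif_pos hex).trans ?_
          exact hc hex.choose_spec⟩, χ ∘ c) : {χ : α → V // ∀ h, χ (c h) = h} × (V → V))) := by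
      intro χ χ' he
      rw [Prod.mk.injEq, Subtype.mk.injEq] at he
      funext a
      by_cases ha : ∃ v, c v = a
      · obtain ⟨v, rfl⟩ := ha
        exact congrFun he.2 v
      · simpa only [dif_neg ha] using congrFun he.1 a
    have := Fintype.card_le_of_injective _ hinj
    rw [Fintype.card_prod, Fintype.card_fun, Fintype.card_fun, Fintype.card_subtype, mul_comm] at this
    exact_mod_cast this
  by_contra! hlt
  have hV : (0 : ℝ) < Fintype.card V := by exact_mod_cast Fintype.card_pos
  have hs := Finset.sum_lt_sum_of_nonempty (s := (Finset.univ : Finset (α → V)))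
    Finset.univ_nonempty fun χ _ => hlt χ
  rw [← Finset.mul_sum, Finset.sum_const, Finset.card_univ, Fintype.card_fun, nsmul_eq_mul] at hs
  push_cast at hs
  refine absurd hs (not_lt.2 ?_)
  simp only [Finset.sum_filter]
  rw [Finset.sum_comm, Finset.mul_sum, Finset.mul_sum]
  refine Finset.sum_le_sum fun c _ => ?_
  rw [← Finset.sum_filter, Finset.sum_const, nsmul_eq_mul, ← mul_assoc]
  by_cases hc : w c = 0
  · simp [hc]
  · exact mul_le_mul_of_nonneg_right (hcount c (hw c hc)) (hw0 c)

open Classical in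
/-- Restricting to a suitable set of host vertices leaves at least half of the weight, and every
remaining vertex carries at least half of the average weight. -/
theorem exists_heavy_restriction {V α : Type*} [Fintype V] [Fintype α] [Nonempty α]
    (w : (V → α) → ℝ) (hw0 : ∀ c, 0 ≤ w c) :
    ∃ A : Finset α, (∑ c, w c) / 2 ≤ ∑ c with ∀ h, c h ∈ A, w c ∧
      ∀ v ∈ A, (∑ c, w c) / (2 * Fintype.card α) ≤
        ∑ c with (∀ h, c h ∈ A) ∧ ∃ h, c h = v, w c := by
  set δ := (∑ c, w c) / (2 * Fintype.card α) with hδ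
  have hα : (0 : ℝ) < Fintype.card α := by exact_mod_cast Fintype.card_pos
  -- `A` maximises retained weight minus a price `δ` per vertex. Comparison with the full set bounds
  -- the retained weight; comparison with `A.erase v` shows that `v` is worth its price.
  obtain ⟨A, -, hA⟩ := Finset.exists_max_image (Finset.univ : Finset (Finset α))
    (fun A => (∑ c with ∀ h, c h ∈ A, w c) - A.card * δ) Finset.univ_nonempty
  refine ⟨A, ?_, fun v hv => ?_⟩
  · have := hA Finset.univ (Finset.mem_univ _)
    simp only [Finset.mem_univ, implies_true, Finset.filter_true, Finset.card_univ] at this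
    have e : (Fintype.card α : ℝ) * δ = (∑ c, w c) / 2 := by rw [hδ]; field_simp
    have hs : 0 ≤ ∑ c, w c := Finset.sum_nonneg fun c _ => hw0 c
    have hδA : 0 ≤ (A.card : ℝ) * δ := by rw [hδ]; positivity
    linarith
  · have := hA (A.erase v) (Finset.mem_univ _)
    rw [Finset.card_erase_of_mem hv, Nat.cast_sub (Finset.card_pos.2 ⟨v, hv⟩)] at this
    have e : ∑ c with ∀ h, c h ∈ A, w c = ∑ c with (∀ h, c h ∈ A) ∧ ∃ h, c h = v, w c +
        ∑ c with ∀ h, c h ∈ A.erase v, w c := by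
      rw [← Finset.sum_filter_add_sum_filter_not _ (fun c => ∃ h, c h = v), Finset.filter_filter,
        Finset.filter_filter]
      congr 2
      ext c
      simp only [Finset.mem_filter, Finset.mem_univ, true_and, Finset.mem_erase, not_exists]
      exact ⟨fun h x => ⟨h.2 x, h.1 x⟩, fun h => ⟨fun x => (h x).2, fun x => (h x).1⟩⟩
    push_cast at this
    linarith

open Classical in
/-- The structure extracted from a function that is far from `H`-freeness: a weighting of the copies
of `H` that respect a colouring of the host vertices, in which every vertex is either unused or used
substantially. -/
theorem exists_robust_packing {V : Type*} [Fintype V] [Nonempty V] {H : SimpleGraph V} {t n : ℕ}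
    (ht : 1 ≤ t) (hE : H.edgeFinset.card = t) (hV : Fintype.card V = t + 1) (hn : 1 ≤ n)
    {μ : Edge n → ℝ} (h0 : ∀ e, 0 ≤ μ e) {f : Edge n → Bool} {ε : ℝ}
    (hfar : ∀ g ∈ freeProperty H n, ε ≤ dist μ f g) :
    ∃ (w : (V → Fin n) → ℝ) (χ : Fin n → V) (W₀ : ℝ), (∀ c, 0 ≤ w c) ∧
      (∀ c, w c ≠ 0 → IsCopy H (toGraph f) c) ∧ (∀ c, w c ≠ 0 → ∀ h, χ (c h) = h) ∧
      (∀ k, (∑ c, if k ∈ H.edgeFinset.image (Sym2.map c) then w c else 0) ≤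
        fibreMass μ Subtype.val k) ∧
      ε ≤ t * ((t + 1) ^ (t + 1) * W₀) ∧ W₀ / 2 ≤ ∑ c, w c ∧
      ∀ h v, (∑ c with c h = v, w c) = 0 ∨ W₀ / (2 * n) ≤ ∑ c with c h = v, w c := by
  obtain ⟨w, hw0, hwc, hle, hε⟩ := exists_packing_of_far ht hE h0 hfar
  obtain ⟨χ, hχ⟩ := exists_colouring w hw0 fun c hc => (hwc c hc).1
  have : Nonempty (Fin n) := ⟨⟨0, hn⟩⟩
  set w₁ : (V → Fin n) → ℝ := fun c => if ∀ h, χ (c h) = h then w c else 0 with hw₁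
  obtain ⟨A, hA, hAv⟩ := exists_heavy_restriction w₁ fun c => by
    simp only [hw₁]
    split_ifs
    exacts [hw0 c, le_rfl]
  set w₂ : (V → Fin n) → ℝ := fun c => if ∀ h, c h ∈ A then w₁ c else 0 with hw₂
  have hne : ∀ c, w₂ c ≠ 0 → (∀ h, c h ∈ A) ∧ (∀ h, χ (c h) = h) ∧ w c ≠ 0 := by
    intro c hc
    simp only [hw₂, hw₁, ne_eq, ite_eq_right_iff, Classical.not_imp] at hc
    exact ⟨hc.1, hc.2.1, hc.2.2⟩
  have h20 : ∀ c, 0 ≤ w₂ c := by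
    intro c
    simp only [hw₂, hw₁]
    split_ifs
    exacts [hw0 c, le_rfl, le_rfl]
  have h2le : ∀ c, w₂ c ≤ w c := by
    intro c
    simp only [hw₂, hw₁]
    split_ifs
    exacts [le_rfl, hw0 c, hw0 c]
  refine ⟨w₂, χ, ∑ c, w₁ c, h20, fun c hc => hwc c (hne c hc).2.2, fun c hc => (hne c hc).2.1,
    ?_, ?_, ?_, ?_⟩
  · intro k
    refine le_trans (Finset.sum_le_sum fun c _ => ?_) (hle k)
    split_ifs
    exacts [h2le c, le_rfl]
  · rw [hV] at hχ
    push_cast at hχ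
    rw [Finset.sum_filter] at hχ
    exact hε.trans (mul_le_mul_of_nonneg_left hχ (Nat.cast_nonneg t))
  · rw [Finset.sum_filter] at hA
    convert hA
  · intro h v
    by_cases hz : ∃ c, w₂ c ≠ 0 ∧ c h = v
    · right
      obtain ⟨c₀, hc₀, rfl⟩ := hz
      have h1 := hAv (c₀ h) ((hne c₀ hc₀).1 h)
      rw [Fintype.card_fin] at h1
      refine h1.trans (le_of_eq ?_)
      rw [Finset.sum_filter, Finset.sum_filter]
      refine Finset.sum_congr rfl fun c _ => ?_
      by_cases hc : w₂ c = 0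
      · rw [hc, ite_self]
        simp only [hw₂] at hc
        split_ifs with h3
        · rwa [if_pos h3.1] at hc
        · rfl
      · have e : (∀ h, c h ∈ A) := (hne c hc).1
        have e' : w₂ c = w₁ c := by simp only [hw₂]; rw [if_pos e]
        rw [e']
        -- The colour of a host vertex determines the only vertex of `H` that can be sent to it, so
        -- being used at all means being used in this role.
        have : ((∀ h, c h ∈ A) ∧ ∃ h', c h' = c₀ h) ↔ c h = c₀ h := by
          constructor
          · rintro ⟨_, h', hh'⟩
            have e1 := (hne c hc).2.1 h'
            rw [hh', (hne c₀ hc₀).2.1 h] at e1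
            rw [e1, hh', e1]
          · exact fun hh => ⟨e, h, hh⟩
        simp only [this]
    · left
      refine Finset.sum_eq_zero fun c hc => ?_
      by_contra hcn
      exact hz ⟨c, hcn, (Finset.mem_filter.1 hc).2⟩

end EdgeTesting

/-! ### The copy-finding tester and the upper bound -/

namespace EdgeTesting

open Growth

section Flow

variable {V : Type*} [Fintype V] {n : ℕ}

open Classical in
/-- The mass that a weighting of maps `V → Fin n` puts on sending `ν j` to `v`. -/
noncomputable def vertexMass (w : (V → Fin n) → ℝ) (ν : ℕ → V) (j : ℕ) (v : Fin n) : ℝ :=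
  ∑ c with c (ν j) = v, w c

open Classical in
/-- The mass that a weighting of maps `V → Fin n` puts on sending the `i`-th tree edge to `v u`. -/
noncomputable def edgeMass (w : (V → Fin n) → ℝ) (ν : ℕ → V) (π : ℕ → ℕ) (i : ℕ)
    (v u : Fin n) : ℝ :=
  ∑ c with c (ν (π i)) = v ∧ c (ν (i + 1)) = u, w c

/-- Vertex and edge masses are marginals of one weighting, hence consistent along the tree. -/
theorem isFlow_mass {w : (V → Fin n) → ℝ} (hw : ∀ c, 0 ≤ w c) (ν : ℕ → V) {π : ℕ → ℕ}
    (hπ : ∀ i, π i ≤ i) (t : ℕ) : IsFlow t π (vertexMass w ν) (edgeMass w ν π) where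
  parent_le := hπ
  p_nonneg _ _ := Finset.sum_nonneg fun c _ => hw c
  x_nonneg _ _ _ := Finset.sum_nonneg fun c _ => hw c
  sum_right i _ v := by
    classical
    simp only [vertexMass, edgeMass, ← Finset.filter_filter]
    exact Finset.sum_fiberwise (f := w) _ _
  sum_left i _ u := by
    classical
    simp only [vertexMass, edgeMass, and_comm (b := _ = u), ← Finset.filter_filter]
    exact Finset.sum_fiberwise (f := w) _ _

open Classical in
theorem sum_vertexMass (w : (V → Fin n) → ℝ) (ν : ℕ → V) (j : ℕ) :
    ∑ v, vertexMass w ν j v = ∑ c, w c :=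
  Finset.sum_fiberwise (f := w) _ _

theorem exists_of_vertexMass_ne_zero {w : (V → Fin n) → ℝ} {ν : ℕ → V} {j : ℕ} {v : Fin n}
    (h : vertexMass w ν j v ≠ 0) : ∃ c, w c ≠ 0 ∧ c (ν j) = v := by
  obtain ⟨c, hc, hne⟩ := Finset.exists_ne_zero_of_sum_ne_zero h
  exact ⟨c, hne, (Finset.mem_filter.1 hc).2⟩

theorem exists_of_edgeMass_ne_zero {w : (V → Fin n) → ℝ} {ν : ℕ → V} {π : ℕ → ℕ} {i : ℕ}
    {v u : Fin n} (h : edgeMass w ν π i v u ≠ 0) :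
    ∃ c, w c ≠ 0 ∧ c (ν (π i)) = v ∧ c (ν (i + 1)) = u := by
  obtain ⟨c, hc, hne⟩ := Finset.exists_ne_zero_of_sum_ne_zero h
  exact ⟨c, hne, (Finset.mem_filter.1 hc).2⟩

end Flow

/-- The indicator function of the sampled edges with label `true`. -/
noncomputable def sampledEdges {n M : ℕ} (z : Fin M → Edge n × Bool) : Edge n → Bool :=
  open Classical in fun e => decide (∃ k, z k = (e, true))

/-- The tester that accepts unless the sampled edges contain a copy of `H`. -/
noncomputable def copyTester {V : Type*} (H : SimpleGraph V) (n M : ℕ) : Algorithm (Edge n) M :=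
  open Classical in fun z => if H.Free (toGraph (sampledEdges z)) then 1 else 0

/-- The sampled graph is a subgraph of the graph of `f`, so the error is one-sided. -/
theorem acceptProb_copyTester_of_mem {V : Type*} {H : SimpleGraph V} {n M : ℕ} {μ : Edge n → ℝ}
    (h1 : ∑ e, μ e = 1) {f : Edge n → Bool} (hf : f ∈ freeProperty H n) :
    acceptProb (copyTester H n M) μ f = 1 := by
  have hA : ∀ x : Fin M → Edge n, copyTester H n M (fun i => (x i, f (x i))) = 1 := by
    intro x
    refine if_pos fun hcon => hf ?_
    obtain ⟨c, hc⟩ := exists_isCopy hcon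
    refine IsCopy.isContained (c := c) ⟨hc.1, fun a b hab => ?_⟩
    obtain ⟨e, he, hs⟩ := toGraph_adj.1 (hc.2 a b hab)
    obtain ⟨k, hk⟩ := of_decide_eq_true hs
    rw [Prod.mk.injEq] at hk
    exact toGraph_adj.2 ⟨e, he, hk.1 ▸ hk.2⟩
  simp only [acceptProb, hA]
  simpa using sum_prod_eq_one (J := Fin M) h1

theorem rejectProb_eq {Λ : Type*} [Fintype Λ] {M : ℕ} (A : Algorithm Λ M) {μ : Λ → ℝ}
    (h1 : ∑ e, μ e = 1) (f : Λ → Bool) : rejectProb A μ f = 1 - acceptProb A μ f := by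
  classical
  simp only [rejectProb, acceptProb, mul_sub, mul_one, Finset.sum_sub_distrib,
    sum_prod_eq_one h1]

/-- Splitting `t * m` samples into `t` blocks of `m` samples. -/
def blockEquiv (Λ : Type*) (t m : ℕ) : (Fin (t * m) → Λ) ≃ (Fin t → Fin m → Λ) :=
  (Equiv.arrowCongr finProdFinEquiv.symm (Equiv.refl Λ)).trans (Equiv.curry _ _ _)

theorem blockEquiv_apply {Λ : Type*} {t m : ℕ} (x : Fin (t * m) → Λ) (i : Fin t) (j : Fin m) :
    blockEquiv Λ t m x i j = x (finProdFinEquiv (i, j)) := rfl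

theorem prod_blockEquiv {Λ : Type*} {t m : ℕ} (μ : Λ → ℝ) (x : Fin (t * m) → Λ) :
    ∏ i, ∏ j, μ (blockEquiv Λ t m x i j) = ∏ k, μ (x k) := by
  simp only [blockEquiv_apply]
  rw [← Fintype.prod_prod_type' (f := fun i j => μ (x (finProdFinEquiv (i, j))))]
  exact Fintype.prod_equiv finProdFinEquiv _ _ fun _ => rfl

/-- The arithmetic behind the choice of the number of samples. -/
theorem le_third_of_second_moment {t : ℕ} (ht' : (1 : ℝ) ≤ t) {n N m W W₀ Q θ : ℝ} (hN : 1 ≤ N)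
    (hNt : N ^ t = n) (hm0' : 0 < m) (hy0 : 0 < m * W₀)
    (hy : 2 * t * 3 ^ t * N ^ (t - 1) ≤ m * W₀) (hWpos : 0 < W) (hW : W₀ / 2 ≤ W)
    (hθ0 : 0 ≤ θ) (hθ : θ = 2 * n / (m * W₀))
    (hb1 : (1 + θ) * (W ^ 2 * Q) ≤ t * (1 + θ) ^ t * (W / m)) : Q ≤ 1 / 3 := by
  have ht : 1 ≤ t := by exact_mod_cast ht'
  have hNn : n = N * N ^ (t - 1) := by
    rw [← hNt, ← pow_succ']
    congr 1
    omega
  have hN0 : (0 : ℝ) < N ^ (t - 1) := by positivity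
  have h3 : (1 : ℝ) ≤ 3 ^ t := one_le_pow₀ (by norm_num)
  -- Here `n = N * N ^ (t - 1)` and `m W₀ ≥ N ^ (t - 1)`. Then `1 + θ ≤ 3 N`, which is the source of
  -- `3 ^ t` in the sample bound.
  have hθN : θ ≤ 2 * N := by
    rw [hθ, div_le_iff₀ hy0, hNn]
    have : N ^ (t - 1) ≤ 2 * t * 3 ^ t * N ^ (t - 1) := by
      have : (1 : ℝ) ≤ 2 * t * 3 ^ t := by nlinarith
      nlinarith
    nlinarith
  have hpow : (1 + θ) ^ (t - 1) ≤ 3 ^ (t - 1) * N ^ (t - 1) := by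
    rw [← mul_pow]
    exact pow_le_pow_left₀ (by linarith) (by linarith) _
  have hsplit : (1 + θ) ^ t = (1 + θ) * (1 + θ) ^ (t - 1) := by
    rw [← pow_succ']
    congr 1
    omega
  have hsplit3 : (3 : ℝ) ^ t = 3 * 3 ^ (t - 1) := by
    rw [← pow_succ']
    congr 1
    omega
  have hb2 : W ^ 2 * Q ≤ t * (1 + θ) ^ (t - 1) * (W / m) := by
    refine le_of_mul_le_mul_left (hb1.trans (le_of_eq ?_)) (show 0 < 1 + θ by linarith)
    rw [hsplit]
    ring
  have hb3 : m * W * Q ≤ t * (1 + θ) ^ (t - 1) := by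
    have e : W * (m * W * Q) = m * (W ^ 2 * Q) := by ring
    have e' : m * (t * (1 + θ) ^ (t - 1) * (W / m)) = W * (t * (1 + θ) ^ (t - 1)) := by
      field_simp
    refine le_of_mul_le_mul_left ?_ hWpos
    rw [e, ← e']
    exact mul_le_mul_of_nonneg_left hb2 hm0'.le
  have hb4 : 3 * (t * (1 + θ) ^ (t - 1)) ≤ m * W := by
    have : t * (1 + θ) ^ (t - 1) ≤ t * (3 ^ (t - 1) * N ^ (t - 1)) :=
      mul_le_mul_of_nonneg_left hpow (by linarith)
    have h5 : m * W₀ ≤ 2 * (m * W) := by nlinarith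
    rw [hsplit3] at hy
    nlinarith
  have hmW : 0 < m * W := by positivity
  rw [le_div_iff₀ (by norm_num)]
  refine le_of_mul_le_mul_left ?_ hmW
  linarith

/-- With enough samples, a function that is far from `H`-freeness is accepted with probability at
most `1 / 3`. -/
theorem acceptProb_copyTester_le {V : Type*} [Finite V] {H : SimpleGraph V} (hH : H.IsTree)
    {t n m : ℕ} (ht : 1 ≤ t) (hE : H.edgeSet.ncard = t) (hn : 1 ≤ n) {μ : Edge n → ℝ}
    (h0 : ∀ e, 0 ≤ μ e) (h1 : ∑ e, μ e = 1) {f : Edge n → Bool} {ε N : ℝ}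
    (hfar : ∀ g ∈ freeProperty H n, ε ≤ dist μ f g) (hN : 1 ≤ N) (hNt : N ^ t = n)
    (hm : 2 * t * 3 ^ t * N ^ (t - 1) * (t * (t + 1) ^ (t + 1)) ≤ m * ε) :
    acceptProb (copyTester H n (t * m)) μ f ≤ 1 / 3 := by
  classical
  have := Fintype.ofFinite V
  obtain ⟨ν, π, hπ, hinj, hsurj, hadj, hedge⟩ := exists_growth_order hH hE
  have hcardE : H.edgeFinset.card = t := by
    rw [← hE, ← SimpleGraph.coe_edgeFinset, Set.ncard_coe_finset]
  have hcard : Fintype.card V = t + 1 := by rw [← hH.card_edgeFinset, hcardE]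
  have : Nonempty V := hH.connected.nonempty
  obtain ⟨w, χ, W₀, hw0, hwc, hχ, hle, hεW, hW, hheavy⟩ :=
    exists_robust_packing ht hcardE hcard hn h0 hfar
  have ht' : (1 : ℝ) ≤ t := by exact_mod_cast ht
  have hn' : (1 : ℝ) ≤ n := by exact_mod_cast hn
  have hm0 : 0 < m := by
    rcases Nat.eq_zero_or_pos m with rfl | h
    · have : 0 < 2 * t * 3 ^ t * N ^ (t - 1) * (t * ((t : ℝ) + 1) ^ (t + 1)) := by positivity
      simp only [Nat.cast_zero, zero_mul] at hm
      linarith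
    · exact h
  have hm0' : (0 : ℝ) < m := by exact_mod_cast hm0
  -- The factor `t (t + 1) ^ (t + 1)` in `hm` pays for the passage from `ε` to `W₀`: `t` for the
  -- packing, the power for the colouring.
  have hy : 2 * t * 3 ^ t * N ^ (t - 1) ≤ m * W₀ := by
    have hpos : (0 : ℝ) < t * (t + 1) ^ (t + 1) := by positivity
    refine le_of_mul_le_mul_right (hm.trans ?_) hpos
    nlinarith
  have hy0 : 0 < m * W₀ := lt_of_lt_of_le (by positivity) hy
  have hW0 : 0 < W₀ := pos_of_mul_pos_right hy0 hm0'.le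
  set W := ∑ c, w c with hWdef
  have hWpos : 0 < W := by linarith
  set p := vertexMass w ν with hp
  set x := edgeMass w ν π with hx
  have hflow : IsFlow t π p x := isFlow_mass hw0 ν hπ t
  set θ : ℝ := 2 * n / (m * W₀) with hθ
  have hθ0 : 0 ≤ θ := by positivity
  have hpθ : ∀ j ≤ t, ∀ v, ((m : ℝ) * p j v)⁻¹ ≤ θ := by
    intro j _ v
    rcases hheavy (ν j) v with h | h
    · have : p j v = 0 := by simp only [hp, vertexMass]; convert h
      simp [this, hθ0]
    · have h : W₀ / (2 * n) ≤ p j v := by simp only [hp, vertexMass]; convert h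
      have e : θ = (m * (W₀ / (2 * n)))⁻¹ := by rw [hθ]; field_simp
      rw [e]
      exact inv_anti₀ (by positivity) (mul_le_mul_of_nonneg_left h hm0'.le)
  have hχp : ∀ j v, p j v ≠ 0 → χ v = ν j := by
    intro j v h
    obtain ⟨c, hc, rfl⟩ := exists_of_vertexMass_ne_zero h
    exact hχ c hc _
  -- The packing respects capacities, so rewards `1 / (m x)` dominate the true `1 / (m q)`.
  have hxle : ∀ i < t, ∀ v u, x i v u ≤ fibreMass μ Subtype.val s(v, u) := by
    intro i hi v u
    refine le_trans ?_ (hle s(v, u))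
    simp only [hx, edgeMass]
    rw [Finset.sum_filter]
    refine Finset.sum_le_sum fun c _ => ?_
    by_cases h : c (ν (π i)) = v ∧ c (ν (i + 1)) = u
    · rw [if_pos h, if_pos]
      refine Finset.mem_image.2 ⟨s(ν (π i), ν (i + 1)), SimpleGraph.mem_edgeFinset.2 (hadj i hi), ?_⟩
      rw [Sym2.map_mk, ← h.1, ← h.2]
    · rw [if_neg h]
      split_ifs
      exacts [hw0 c, le_rfl]
  set ω := Growth.weight (p 0) π (flowKernel π p x) t with hω
  set a : Growth (Fin n) t → Fin t → Sym2 (Fin n) :=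
    fun c i => s(coord t c (π i), coord t c (i + 1)) with ha
  have hxpos : ∀ c, ω c ≠ 0 → ∀ i : Fin t, 0 < x i (coord t c (π i)) (coord t c (i + 1)) :=
    fun c hc i => lt_of_le_of_ne (hflow.x_nonneg _ _ _)
      (hflow.x_coord_ne_zero t le_rfl c hc i i.2).symm
  have hχc : ∀ c, ω c ≠ 0 → ∀ j ≤ t, χ (coord t c j) = ν j :=
    fun c hc j hj => hχp j _ (hflow.p_coord_ne_zero le_rfl hc hj)
  have hcov := sum_not_covers_le (t := t) hm0 h0 h1 Subtype.val ω (hflow.weight_nonneg t) a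
    (fun c hc i => (hxpos c hc i).trans_le (hxle i i.2 _ _))
    (fun c c' i => collision π x m i (coord t c) (coord t c'))
    (fun c c' i => hflow.collision_nonneg hm0'.le _ _ _)
    (by
      intro c c' hc hc' i he
      have hi := i.2
      have hpi := hπ i
      have hpi' : (π i : ℕ) ≠ i + 1 := by omega
      have hcoord : coord t c (π i) = coord t c' (π i) ∧
          coord t c (i + 1) = coord t c' (i + 1) := by
        rcases Sym2.eq_iff.1 he with h | h
        · exact h
        -- Labels are unordered pairs; the colours rule out that two configurations use the same
        -- edge with opposite orientations.
        · exfalso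
          have e1 := hχc c hc (π i) (by omega)
          rw [h.1, hχc c' hc' (i + 1) (by omega)] at e1
          exact hpi' (hinj _ (by omega) _ (by omega) e1).symm
      rw [collision, if_pos hcoord]
      exact inv_anti₀ (mul_pos hm0' (hxpos c hc i))
        (mul_le_mul_of_nonneg_left (hxle i i.2 _ _) hm0'.le))
  have hmom := hflow.sum_pair_prod_le hm0' hθ0 hpθ t le_rfl
  rw [hp, sum_vertexMass, ← hWdef, ← hp] at hmom
  have hV : ∑ c, ω c = W := by rw [hω, hflow.sum_weight le_rfl, hp, sum_vertexMass]
  simp only [Finset.prod_range] at hmom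
  rw [hV] at hcov
  set Q := ∑ y : Fin t → Fin m → Edge n with ¬ Covers ω a Subtype.val y, ∏ i, ∏ j, μ (y i j) with hQ
  have hQ0 : Q ≤ 1 / 3 :=
    le_third_of_second_moment ht' hN hNt hm0' hy0 hy hWpos hW hθ0 hθ
      ((mul_le_mul_of_nonneg_left hcov (by linarith)).trans hmom)
  refine le_trans ?_ hQ0
  have haccept : ∀ z : Fin (t * m) → Edge n, Covers ω a Subtype.val (blockEquiv _ t m z) →
      copyTester H n (t * m) (fun k => (z k, f (z k))) = 0 := by
    rintro z ⟨c, hc, hcz⟩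
    refine if_neg fun hfree => hfree ?_
    choose idx hidx hνidx using hsurj
    have hidxν : ∀ j ≤ t, idx (ν j) = j := fun j hj => hinj _ (hidx _) _ hj (hνidx _)
    refine IsCopy.isContained (c := fun v => coord t c (idx v)) ⟨?_, ?_⟩
    · intro v v' he
      have := congrArg χ he
      simpa only [hχc c hc _ (hidx _), hνidx] using this
    · intro v v' hvv'
      obtain ⟨i, hi, he⟩ := hedge v v' hvv'
      obtain ⟨j, hj⟩ := hcz ⟨i, hi⟩
      have hpi := hπ i
      have hs : s(coord t c (idx v), coord t c (idx v')) =
          s(coord t c (π i), coord t c (i + 1)) := by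
        have := congrArg (Sym2.map fun v => coord t c (idx v)) he
        simpa only [Sym2.map_mk, hidxν (π i) (by omega), hidxν (i + 1) (by omega)] using this
      -- The configuration `c` need not belong to the packing, but each of its edges lies in some
      -- packed copy `c'` and so is an edge of `f`.
      obtain ⟨c', hc', e1, e2⟩ := exists_of_edgeMass_ne_zero (hxpos c hc ⟨i, hi⟩).ne'
      have hf := (hwc c' hc').2 _ _ (hadj i hi)
      rw [e1, e2] at hf
      obtain ⟨e, hev, hfe⟩ := toGraph_adj.1 hf
      have hez : z (finProdFinEquiv (⟨i, hi⟩, j)) = e := Subtype.ext (hj.trans hev.symm)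
      exact toGraph_adj.2 ⟨e, hev.trans hs.symm, decide_eq_true
        ⟨finProdFinEquiv (⟨i, hi⟩, j), by simp only [hez, hfe]⟩⟩
  calc acceptProb (copyTester H n (t * m)) μ f
      ≤ ∑ z : Fin (t * m) → Edge n, if ¬ Covers ω a Subtype.val (blockEquiv _ t m z) then
          ∏ i, ∏ j, μ (blockEquiv _ t m z i j) else 0 := by
        refine Finset.sum_le_sum fun z _ => ?_
        split_ifs with h
        · rw [haccept z h]
          simp
        · rw [prod_blockEquiv]
          exact mul_le_of_le_one_right (Finset.prod_nonneg fun _ _ => h0 _) (unitInterval.le_one _)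
    _ = Q := by
        rw [hQ, Finset.sum_filter]
        exact Equiv.sum_comp (blockEquiv (Edge n) t m)
          (fun y => if ¬ Covers ω a Subtype.val y then ∏ i, ∏ j, μ (y i j) else 0)

/-- A number of samples of order `n ^ ((t - 1) / t) / ε` suffices. -/
theorem exists_isTester_freeProperty {V : Type*} [Finite V] {H : SimpleGraph V} (hH : H.IsTree)
    {t n : ℕ} (ht : 1 ≤ t) (hE : H.edgeSet.ncard = t) (hn : 1 ≤ n) {ε : ℝ} (hε : 0 < ε)
    (hε1 : ε ≤ 1) :
    ∃ M : ℕ, 0 < M ∧ (∃ A : Algorithm (Edge n) M, IsTester (freeProperty H n) ε A) ∧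
      (M : ℝ) ≤ t * (2 * t * 3 ^ t * (t * (t + 1) ^ (t + 1)) + 1) *
        (n : ℝ) ^ (((t : ℝ) - 1) / t) / ε := by
  have ht' : (1 : ℝ) ≤ t := by exact_mod_cast ht
  have hn' : (1 : ℝ) ≤ n := by exact_mod_cast hn
  set N : ℝ := (n : ℝ) ^ ((t : ℝ)⁻¹) with hN
  have hN1 : 1 ≤ N := Real.one_le_rpow hn' (by positivity)
  have hNt : N ^ t = n := Real.rpow_inv_natCast_pow (by positivity) (by omega)
  have hNt1 : N ^ (t - 1) = (n : ℝ) ^ (((t : ℝ) - 1) / t) := by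
    rw [hN, ← Real.rpow_natCast, ← Real.rpow_mul (by positivity), Nat.cast_sub ht]
    congr 1
    push_cast
    field_simp
  have hNp : 1 ≤ N ^ (t - 1) := one_le_pow₀ hN1
  rw [← hNt1]
  set B : ℝ := 2 * t * 3 ^ t * (t * (t + 1) ^ (t + 1)) with hB
  have hB0 : 0 < B := by positivity
  set m : ℕ := ⌈B * N ^ (t - 1) / ε⌉₊ with hm
  have hm0 : 0 < m := Nat.ceil_pos.2 (by positivity)
  have hm1 : B * N ^ (t - 1) / ε ≤ m := Nat.le_ceil _
  -- Rounding up costs at most `1 ≤ N ^ (t - 1) / ε`, absorbed by `B + 1`.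
  have hm2 : (m : ℝ) ≤ (B + 1) * N ^ (t - 1) / ε := by
    refine (Nat.ceil_lt_add_one (by positivity)).le.trans ?_
    rw [add_mul, add_div, one_mul]
    gcongr
    rw [one_le_div hε]
    linarith
  refine ⟨t * m, Nat.mul_pos (by omega) hm0, ⟨copyTester H n (t * m), ?_⟩, ?_⟩
  · intro μ hμ f
    refine ⟨fun hf => ?_, fun hfar => ?_⟩
    · rw [acceptProb_copyTester_of_mem hμ.2 hf]
      norm_num
    · rw [rejectProb_eq _ hμ.2]
      have := acceptProb_copyTester_le (m := m) hH ht hE hn hμ.1 hμ.2 hfar hN1 hNt (by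
        rw [div_le_iff₀ hε] at hm1
        refine le_trans (le_of_eq ?_) hm1
        rw [hB]
        ring)
      linarith
  · push_cast
    calc (t : ℝ) * m ≤ t * ((B + 1) * N ^ (t - 1) / ε) := by gcongr
      _ = _ := by ring

end EdgeTesting

/-! ### Sampling through a uniformly random index -/

namespace EdgeTesting

section Pushforward

variable {Λ I : Type*} [Fintype Λ] [Fintype I]

open Classical in
/-- The distribution of `ed i` for a uniformly random `i`. -/
noncomputable def uniformImage (ed : I → Λ) (x : Λ) : ℝ :=
  ∑ i, if ed i = x then (Fintype.card I : ℝ)⁻¹ else 0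

theorem uniformImage_mem_stdSimplex [Nonempty I] (ed : I → Λ) :
    uniformImage ed ∈ stdSimplex ℝ Λ := by
  classical
  refine ⟨fun x => Finset.sum_nonneg fun i _ => by split_ifs <;> positivity, ?_⟩
  unfold uniformImage
  rw [Finset.sum_comm]
  simp

/-- Replaces sampling in `Λ` by uniform sampling of indices, so that events can be counted in `I`.
-/
theorem acceptProb_uniformImage (ed : I → Λ) {m : ℕ} (A : Algorithm Λ m) (f : Λ → Bool) :
    acceptProb A (uniformImage ed) f =
      ∑ y : Fin m → I, (Fintype.card I : ℝ)⁻¹ ^ m * (A fun k => (ed (y k), f (ed (y k))) : ℝ) := by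
  classical
  simp only [acceptProb, uniformImage]
  have e : ∀ x : Fin m → Λ, (∏ k, ∑ i, if ed i = x k then (Fintype.card I : ℝ)⁻¹ else 0) =
      ∑ y : Fin m → I, if ed ∘ y = x then (Fintype.card I : ℝ)⁻¹ ^ m else 0 := by
    intro x
    rw [Finset.prod_univ_sum, Fintype.piFinset_univ]
    refine Finset.sum_congr rfl fun y _ => ?_
    split_ifs with h
    · rw [← h]
      simp
    · obtain ⟨k, hk⟩ := Function.ne_iff.1 h
      exact Finset.prod_eq_zero (Finset.mem_univ k) (if_neg hk)
  simp only [e, Finset.sum_mul]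
  rw [Finset.sum_comm]
  refine Finset.sum_congr rfl fun y _ => ?_
  simp only [ite_mul, zero_mul, Finset.sum_ite_eq, Finset.mem_univ, if_true]
  rfl

theorem le_dist_uniformImage {β : Type*} [Fintype β] (ed : I → Λ) (f g : Λ → Bool) (i : β → I)
    (hi : Function.Injective i) (h : ∀ b, f (ed (i b)) ≠ g (ed (i b))) :
    Fintype.card β * (Fintype.card I : ℝ)⁻¹ ≤ dist (uniformImage ed) f g := by
  classical
  unfold dist uniformImage
  rw [Finset.sum_comm]
  calc (Fintype.card β : ℝ) * (Fintype.card I : ℝ)⁻¹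
      = ∑ j ∈ Finset.univ.image i, (Fintype.card I : ℝ)⁻¹ := by
        rw [Finset.sum_const, Finset.card_image_of_injective _ hi, Finset.card_univ, nsmul_eq_mul]
    _ ≤ ∑ j ∈ Finset.univ.image i, ∑ x with f x ≠ g x,
          (if ed j = x then (Fintype.card I : ℝ)⁻¹ else 0) := by
        refine Finset.sum_le_sum fun j hj => ?_
        obtain ⟨b, -, rfl⟩ := Finset.mem_image.1 hj
        rw [Finset.sum_ite_eq, if_pos]
        simpa using h b
    _ ≤ _ := Finset.sum_le_sum_of_subset_of_nonneg (Finset.subset_univ _) fun j _ _ =>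
        Finset.sum_nonneg fun x _ => by split_ifs <;> positivity

end Pushforward

/-! ### Hidden parities: what a sample reveals -/

section Parity

variable {E Z : Type*} {B : ℕ}

/-- The label of the position `(b, z, e)` under the secret `s`. -/
def parityLabel (zz : Z → E → ZMod 2) (s : Fin B → E → ZMod 2) (i : Fin B × Z × E) : Bool :=
  decide (s i.1 i.2.2 + zz i.2.1 i.2.2 = 1)

theorem parityLabel_shift [DecidableEq E] {zz : Z → E → ZMod 2} {s : Fin B → E → ZMod 2}
    {j : Fin B → E} {i : Fin B × Z × E} (h : i.2.2 ≠ j i.1) :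
    parityLabel zz (s + fun b => Pi.single (j b) 1) i = parityLabel zz s i := by
  simp [parityLabel, Pi.single_eq_of_ne h]

variable [Fintype E] [Fintype Z]

open Classical in
/-- The secrets all of whose rows have parity `σ`. -/
noncomputable def paritySecrets (E : Type*) [Fintype E] (B : ℕ) (σ : ZMod 2) :
    Finset (Fin B → E → ZMod 2) :=
  Finset.univ.filter fun s => ∀ b, ∑ e, s b e = σ

theorem mem_paritySecrets {σ : ZMod 2} {s : Fin B → E → ZMod 2} :
    s ∈ paritySecrets E B σ ↔ ∀ b, ∑ e, s b e = σ := by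
  simp [paritySecrets]

/-- Adding a unit vector in every row changes the parity of every row. -/
theorem sum_paritySecrets_shift [DecidableEq E] (τ : ZMod 2) (j : Fin B → E)
    {F G : (Fin B → E → ZMod 2) → ℝ}
    (h : ∀ s, F s = G (s + fun b => Pi.single (j b) 1)) :
    ∑ s ∈ paritySecrets E B τ, F s = ∑ s ∈ paritySecrets E B (τ + 1), G s := by
  refine Finset.sum_equiv (Equiv.addRight fun b => Pi.single (j b) 1) (fun s => ?_) fun s _ => h s
  simp only [mem_paritySecrets, Equiv.coe_addRight, Pi.add_apply, Finset.sum_add_distrib]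
  simp

/-- `y` sees every position of some row. -/
def SeesRow {m : ℕ} (y : Fin m → Fin B × Z × E) : Prop :=
  ∃ b, ∀ e, ∃ k, (y k).1 = b ∧ (y k).2.2 = e

open Classical in
/-- A fixed choice of sample indices sees the row `b` with probability at most `(|E| B)⁻ᵉ`,
`e = |E|`. -/
theorem card_filter_sees_le [Nonempty E] [Nonempty Z] {m : ℕ} (b : Fin B) (j : E → Fin m) :
    ((Finset.univ.filter fun y : Fin m → Fin B × Z × E =>
        ∀ e, (y (j e)).1 = b ∧ (y (j e)).2.2 = e).card : ℝ) *
      (Fintype.card (Fin B × Z × E) : ℝ)⁻¹ ^ m ≤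
      ((Fintype.card E : ℝ) * B)⁻¹ ^ Fintype.card E := by
  have : Nonempty (Fin B) := ⟨b⟩
  have hB : (0 : ℝ) < B := by exact_mod_cast b.pos
  have hI : (0 : ℝ) < Fintype.card (Fin B × Z × E) := by exact_mod_cast Fintype.card_pos
  have hE : (0 : ℝ) < Fintype.card E := by exact_mod_cast Fintype.card_pos
  have hZ : (0 : ℝ) < Fintype.card Z := by exact_mod_cast Fintype.card_pos
  set q : ℝ := ((Fintype.card E : ℝ) * B)⁻¹ with hq
  set S : Fin m → Finset (Fin B × Z × E) := fun k =>
    Finset.univ.filter fun i => ∀ e, j e = k → i.1 = b ∧ i.2.2 = e with hS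
  have hset : (Finset.univ.filter fun y : Fin m → Fin B × Z × E =>
      ∀ e, (y (j e)).1 = b ∧ (y (j e)).2.2 = e) = Fintype.piFinset S := by
    ext y
    simp only [hS, Finset.mem_filter, Finset.mem_univ, true_and, Fintype.mem_piFinset]
    exact ⟨fun h k e he => he ▸ h e, fun h e => h _ e rfl⟩
  have hk : ∀ k, ((S k).card : ℝ) * (Fintype.card (Fin B × Z × E) : ℝ)⁻¹ ≤
      ∏ e with j e = k, q := by
    intro k
    rw [Finset.prod_const]
    -- By the number of positions assigned to sample `k`: none gives a factor at most `1`; one fixes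
    -- the row and position and leaves `z` free; two or more are incompatible.
    by_cases h0 : (Finset.univ.filter fun e => j e = k).card = 0
    · rw [h0, pow_zero, ← div_eq_mul_inv, div_le_one hI]
      exact_mod_cast Finset.card_le_univ _
    · obtain ⟨e, he⟩ := Finset.card_pos.1 (Nat.pos_of_ne_zero h0)
      have he := (Finset.mem_filter.1 he).2
      by_cases h1 : ∃ e', j e' = k ∧ e' ≠ e
      · obtain ⟨e', he', hne⟩ := h1
        have : S k = ∅ := by
          refine Finset.eq_empty_of_forall_notMem fun i hi => hne ?_
          have hi := (Finset.mem_filter.1 hi).2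
          rw [← (hi e he).2, ← (hi e' he').2]
        rw [this, Finset.card_empty, Nat.cast_zero, zero_mul]
        positivity
      · push Not at h1
        have hone : (Finset.univ.filter fun e => j e = k) = {e} := by
          ext e'
          simp only [Finset.mem_filter, Finset.mem_univ, true_and, Finset.mem_singleton]
          exact ⟨h1 e', fun h => h ▸ he⟩
        rw [hone, Finset.card_singleton, pow_one]
        have hcard : (S k).card ≤ Fintype.card Z := by
          have : S k ⊆ Finset.univ.image fun z : Z => (b, z, e) := by
            intro i hi
            have hi := (Finset.mem_filter.1 hi).2 e he
            exact Finset.mem_image.2 ⟨i.2.1, Finset.mem_univ _, by rw [← hi.1, ← hi.2]⟩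
          exact (Finset.card_le_card this).trans Finset.card_image_le
        have hcard' : ((S k).card : ℝ) ≤ Fintype.card Z := by exact_mod_cast hcard
        rw [hq, Fintype.card_prod, Fintype.card_prod, Fintype.card_fin]
        push_cast
        calc ((S k).card : ℝ) * (B * (Fintype.card Z * Fintype.card E) : ℝ)⁻¹
            ≤ Fintype.card Z * (B * (Fintype.card Z * Fintype.card E) : ℝ)⁻¹ := by gcongr
          _ = _ := by field_simp
  rw [hset, Fintype.card_piFinset]
  push_cast
  calc (∏ k, ((S k).card : ℝ)) * (Fintype.card (Fin B × Z × E) : ℝ)⁻¹ ^ m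
      = ∏ k, ((S k).card : ℝ) * (Fintype.card (Fin B × Z × E) : ℝ)⁻¹ := by
        rw [Finset.prod_mul_distrib, Finset.prod_const, Finset.card_univ, Fintype.card_fin]
    _ ≤ ∏ k, ∏ e with j e = k, q :=
        Finset.prod_le_prod (fun k _ => by positivity) fun k _ => hk k
    _ = q ^ Fintype.card E := by
        rw [Finset.prod_fiberwise, Finset.prod_const, Finset.card_univ]

-- Union bound over the `B` rows and the `m ^ |E|` assignments of a sample index to each position.
open Classical in
theorem card_filter_seesRow_le [Nonempty E] [Nonempty Z] {m : ℕ} :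
    ((Finset.univ.filter fun y : Fin m → Fin B × Z × E => SeesRow y).card : ℝ) *
      (Fintype.card (Fin B × Z × E) : ℝ)⁻¹ ^ m ≤
      B * (m / ((Fintype.card E : ℝ) * B)) ^ Fintype.card E := by
  have hsub : (Finset.univ.filter fun y : Fin m → Fin B × Z × E => SeesRow y) ⊆
      (Finset.univ : Finset (Fin B × (E → Fin m))).biUnion fun bj =>
        Finset.univ.filter fun y : Fin m → Fin B × Z × E =>
          ∀ e, (y (bj.2 e)).1 = bj.1 ∧ (y (bj.2 e)).2.2 = e := by
    intro y hy
    obtain ⟨b, hb⟩ := (Finset.mem_filter.1 hy).2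
    choose j hj using hb
    exact Finset.mem_biUnion.2 ⟨(b, j), Finset.mem_univ _,
      Finset.mem_filter.2 ⟨Finset.mem_univ _, hj⟩⟩
  have hcard : ((Finset.univ.filter fun y : Fin m → Fin B × Z × E => SeesRow y).card : ℝ) ≤
      ∑ bj : Fin B × (E → Fin m), ((Finset.univ.filter fun y : Fin m → Fin B × Z × E =>
          ∀ e, (y (bj.2 e)).1 = bj.1 ∧ (y (bj.2 e)).2.2 = e).card : ℝ) := by
    exact_mod_cast (Finset.card_le_card hsub).trans Finset.card_biUnion_le
  calc _ ≤ (∑ bj : Fin B × (E → Fin m), ((Finset.univ.filter fun y : Fin m → Fin B × Z × E =>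
          ∀ e, (y (bj.2 e)).1 = bj.1 ∧ (y (bj.2 e)).2.2 = e).card : ℝ)) *
          (Fintype.card (Fin B × Z × E) : ℝ)⁻¹ ^ m := by gcongr
    _ ≤ ∑ bj : Fin B × (E → Fin m), ((Fintype.card E : ℝ) * B)⁻¹ ^ Fintype.card E := by
        rw [Finset.sum_mul]
        exact Finset.sum_le_sum fun bj _ => card_filter_sees_le bj.1 bj.2
    _ = _ := by
        rw [Finset.sum_const, Finset.card_univ, Fintype.card_prod, Fintype.card_fun,
          Fintype.card_fin, Fintype.card_fin, nsmul_eq_mul, div_eq_mul_inv, mul_pow]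
        push_cast
        ring

/-- If secrets of one parity give functions in `P` and secrets of the other parity give functions
far from `P`, then a tester has to see a whole row with probability at least `1 / 3`. -/
theorem third_le_of_isTester [Nonempty E] [Nonempty Z] {Λ : Type*} [Fintype Λ]
    (hB : 0 < B) (zz : Z → E → ZMod 2) (ed : Fin B × Z × E → Λ)
    (F : (Fin B → E → ZMod 2) → Λ → Bool) (hF : ∀ s i, F s (ed i) = parityLabel zz s i)
    {P : Set (Λ → Bool)} {ε : ℝ} {m : ℕ} {A : Algorithm Λ m} (hA : IsTester P ε A) (τ : ZMod 2)
    (hyes : ∀ s ∈ paritySecrets E B (τ + 1), F s ∈ P)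
    (hno : ∀ s ∈ paritySecrets E B τ, ∀ g ∈ P, ε ≤ dist (uniformImage ed) (F s) g) :
    1 / 3 ≤ B * (m / ((Fintype.card E : ℝ) * B)) ^ Fintype.card E := by
  classical
  have : Nonempty (Fin B) := ⟨⟨0, hB⟩⟩
  refine le_trans ?_ (card_filter_seesRow_le (E := E) (Z := Z) (B := B) (m := m))
  set μ := uniformImage ed with hμ
  have hμS : μ ∈ stdSimplex ℝ Λ := uniformImage_mem_stdSimplex ed
  set r : ℝ := (Fintype.card (Fin B × Z × E) : ℝ)⁻¹ ^ m with hr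
  have hr0 : 0 ≤ r := by positivity
  set a : (Fin B → E → ZMod 2) → (Fin m → Fin B × Z × E) → ℝ :=
    fun s y => (A fun k => (ed (y k), parityLabel zz s (y k)) : ℝ) with ha
  have ha0 : ∀ s y, 0 ≤ a s y := fun s y => unitInterval.nonneg _
  have ha1 : ∀ s y, a s y ≤ 1 := fun s y => unitInterval.le_one _
  have hacc : ∀ s, acceptProb A μ (F s) = ∑ y, r * a s y := by
    intro s
    rw [hμ, acceptProb_uniformImage]
    simp only [hF, ha, hr]
  obtain ⟨e₀⟩ := ‹Nonempty E›
  set c₀ : ℝ := ((paritySecrets E B τ).card : ℝ) with hc₀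
  have hc : ((paritySecrets E B (τ + 1)).card : ℝ) = c₀ := by
    have := sum_paritySecrets_shift τ (fun _ : Fin B => e₀) (F := fun _ => 1) (G := fun _ => 1)
      fun _ => rfl
    simp only [Finset.sum_const, nsmul_eq_mul, mul_one] at this
    exact this.symm
  have hcpos : 0 < c₀ := by
    have : (paritySecrets E B τ).Nonempty :=
      ⟨fun _ => Pi.single e₀ τ, mem_paritySecrets.2 fun b => by simp⟩
    rw [hc₀]
    exact_mod_cast Finset.card_pos.2 this
  have hY : 2 / 3 * c₀ ≤ ∑ s ∈ paritySecrets E B (τ + 1), ∑ y, r * a s y := by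
    rw [← hc, mul_comm, ← nsmul_eq_mul]
    refine Finset.card_nsmul_le_sum _ _ _ fun s hs => ?_
    rw [← hacc]
    exact (hA μ hμS (F s)).1 (hyes s hs)
  have hN : ∑ s ∈ paritySecrets E B τ, ∑ y, r * a s y ≤ 1 / 3 * c₀ := by
    rw [hc₀, mul_comm, ← nsmul_eq_mul]
    refine Finset.sum_le_card_nsmul _ _ _ fun s hs => ?_
    rw [← hacc]
    have := (hA μ hμS (F s)).2 (hno s hs)
    rw [rejectProb_eq _ hμS.2] at this
    linarith
  have hpoint : ∀ y, ∑ s ∈ paritySecrets E B (τ + 1), r * a s y ≤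
      ∑ s ∈ paritySecrets E B τ, r * a s y + if SeesRow y then r * c₀ else 0 := by
    intro y
    split_ifs with hy
    · have h1 : ∑ s ∈ paritySecrets E B (τ + 1), r * a s y ≤ c₀ * r := by
        rw [← hc, ← nsmul_eq_mul]
        exact Finset.sum_le_card_nsmul _ _ _ fun s _ => mul_le_of_le_one_right hr0 (ha1 s y)
      have h2 : 0 ≤ ∑ s ∈ paritySecrets E B τ, r * a s y :=
        Finset.sum_nonneg fun s _ => mul_nonneg hr0 (ha0 s y)
      linarith
    · unfold SeesRow at hy
      push Not at hy
      -- Each row has an unseen position `j b`. Flipping the secret there changes every parity but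
      -- no observed label, so both parity classes produce this sample with the same total
      -- acceptance.
      choose j hj using hy
      rw [add_zero]
      refine le_of_eq (sum_paritySecrets_shift τ j fun s => ?_).symm
      simp only [ha]
      simp only [parityLabel_shift (fun h => hj _ _ rfl h)]
  rw [Finset.sum_comm] at hY hN
  have hfin := hY.trans (Finset.sum_le_sum fun y _ => hpoint y)
  rw [Finset.sum_add_distrib, ← Finset.sum_filter, Finset.sum_const, nsmul_eq_mul] at hfin
  refine le_of_mul_le_mul_right ?_ hcpos
  linarith

end Parity

/-! ### The hidden-parity graphs and the lower bound -/

section Gadget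

variable {V : Type*} {n B : ℕ} {H : SimpleGraph V}

/-- The even `0`-`1` vectors indexed by the edges of `H`. -/
abbrev EvenVector (H : SimpleGraph V) [Fintype H.edgeSet] : Type _ :=
  {z : H.edgeSet → ZMod 2 // ∑ e, z e = 0}

/-- The edge of the host graph at position `e` of the copy of `H` with index `(b, z)`. -/
def gadgetEdge {Z : Type*} (φ : Fin B × Z × V ↪ Fin n) (i : Fin B × Z × H.edgeSet) : Edge n :=
  ⟨Sym2.map (fun v => φ (i.1, i.2.1, v)) i.2.2.val, fun h => H.not_isDiag_of_mem_edgeSet i.2.2.2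
    ((Sym2.isDiag_map (f := fun v => φ (i.1, i.2.1, v))
      fun a b hab => by simpa using hab).1 h)⟩

theorem mem_gadgetEdge {Z : Type*} (φ : Fin B × Z × V ↪ Fin n) (i : Fin B × Z × H.edgeSet)
    {u : Fin n} (hu : u ∈ (gadgetEdge φ i).val) : ∃ v, u = φ (i.1, i.2.1, v) := by
  obtain ⟨v, -, rfl⟩ := Sym2.mem_map.1 hu
  exact ⟨v, rfl⟩

theorem gadgetEdge_injective {Z : Type*} (φ : Fin B × Z × V ↪ Fin n) :
    Function.Injective (gadgetEdge (H := H) φ) := by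
  rintro ⟨b, z, e⟩ ⟨b', z', e'⟩ h
  obtain ⟨u, hu⟩ : ∃ u, u ∈ (gadgetEdge φ (b, z, e)).val := by
    induction (gadgetEdge φ (b, z, e)).val with
    | _ x y => exact ⟨x, Sym2.mem_mk_left _ _⟩
  obtain ⟨v, hv⟩ := mem_gadgetEdge φ _ hu
  obtain ⟨v', hv'⟩ := mem_gadgetEdge φ _ (h ▸ hu)
  have hvv := φ.injective (hv.symm.trans hv')
  simp only [Prod.mk.injEq] at hvv
  obtain ⟨rfl, rfl, -⟩ := hvv
  have hinj : Function.Injective fun v => φ (b, z, v) := fun a b hab => by simpa using hab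
  have := Sym2.map.injective hinj (congrArg Subtype.val h)
  exact congrArg (fun e => (b, z, e)) (Subtype.ext this)

/-- The edge set described by a secret. -/
noncomputable def gadgetFunction {Z : Type*} (φ : Fin B × Z × V ↪ Fin n)
    (zz : Z → H.edgeSet → ZMod 2) (s : Fin B → H.edgeSet → ZMod 2) : Edge n → Bool :=
  open Classical in fun d => decide (∃ i, gadgetEdge φ i = d ∧ parityLabel zz s i = true)

theorem gadgetFunction_eq_true {Z : Type*} {φ : Fin B × Z × V ↪ Fin n}
    {zz : Z → H.edgeSet → ZMod 2} {s : Fin B → H.edgeSet → ZMod 2} {d : Edge n} :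
    gadgetFunction φ zz s d = true ↔ ∃ i, gadgetEdge φ i = d ∧ parityLabel zz s i = true := by
  simp only [gadgetFunction, decide_eq_true_eq]

theorem gadgetFunction_gadgetEdge {Z : Type*} (φ : Fin B × Z × V ↪ Fin n)
    (zz : Z → H.edgeSet → ZMod 2) (s : Fin B → H.edgeSet → ZMod 2) (i : Fin B × Z × H.edgeSet) :
    gadgetFunction φ zz s (gadgetEdge φ i) = parityLabel zz s i := by
  rw [Bool.eq_iff_iff, gadgetFunction_eq_true]
  exact ⟨fun ⟨_, hi, h⟩ => gadgetEdge_injective φ hi ▸ h, fun h => ⟨i, rfl, h⟩⟩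

variable [Fintype H.edgeSet]

/-- Since `H` is connected, a copy of it lies inside one block `(b, z)`. Having as many edges as the
block has positions, it fills the block, which forces `s b + z = 1` everywhere and contradicts the
parity of row `b`. -/
theorem gadgetFunction_mem_freeProperty [Nonempty H.edgeSet] (hH : H.Connected)
    (φ : Fin B × EvenVector H × V ↪ Fin n) {s : Fin B → H.edgeSet → ZMod 2}
    (hs : ∀ b, ∑ e, s b e = (Fintype.card H.edgeSet : ZMod 2) + 1) :
    gadgetFunction φ Subtype.val s ∈ freeProperty H n := by
  intro hcon
  obtain ⟨c, hc⟩ := exists_isCopy hcon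
  have hadj : ∀ a b, H.Adj a b → ∃ i, (gadgetEdge φ i).val = s(c a, c b) ∧
      parityLabel Subtype.val s i = true := by
    intro a b hab
    obtain ⟨d, hd, hf⟩ := toGraph_adj.1 (hc.2 a b hab)
    obtain ⟨i, rfl, hi⟩ := gadgetFunction_eq_true.1 hf
    exact ⟨i, hd, hi⟩
  obtain ⟨⟨d₀, hd₀⟩⟩ := ‹Nonempty H.edgeSet›
  obtain ⟨β, z, hall⟩ : ∃ β z, ∀ a, ∃ v, c a = φ (β, z, v) := by
    induction d₀ with
    | _ a₀ b₀ =>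
      obtain ⟨i, hi, -⟩ := hadj a₀ b₀ hd₀
      refine ⟨i.1, i.2.1, fun a => ?_⟩
      obtain ⟨p⟩ := hH.preconnected a a₀
      induction p with
      | nil => exact mem_gadgetEdge φ i (hi ▸ Sym2.mem_mk_left _ _)
      | cons h p ih =>
        obtain ⟨v, hv⟩ := ih hd₀ hi
        obtain ⟨i', hi', -⟩ := hadj _ _ h
        obtain ⟨v₁, hv₁⟩ := mem_gadgetEdge φ i' (hi' ▸ Sym2.mem_mk_left _ _)
        obtain ⟨v₂, hv₂⟩ := mem_gadgetEdge φ i' (hi' ▸ Sym2.mem_mk_right _ _)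
        have := φ.injective (hv.symm.trans hv₂)
        simp only [Prod.mk.injEq] at this
        exact ⟨v₁, by rw [hv₁, this.1, this.2.1]⟩
  have hedge : ∀ d : H.edgeSet, ∃ e : H.edgeSet,
      (gadgetEdge φ (β, z, e)).val = Sym2.map c d.val ∧ s β e + z.val e = 1 := by
    rintro ⟨d, hd⟩
    induction d with
    | _ a b =>
      obtain ⟨⟨b', z', e⟩, hi, hl⟩ := hadj a b hd
      obtain ⟨v, hv⟩ := hall a
      obtain ⟨v', hv'⟩ := mem_gadgetEdge φ _ (hi ▸ Sym2.mem_mk_left (c a) (c b))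
      have := φ.injective (hv.symm.trans hv')
      simp only [Prod.mk.injEq] at this
      obtain ⟨rfl, rfl, -⟩ := this
      exact ⟨e, hi, of_decide_eq_true hl⟩
  choose ψ hψ1 hψ2 using hedge
  have hinj : Function.Injective ψ := by
    intro d d' h
    have := hψ1 d
    rw [h, hψ1 d'] at this
    exact Subtype.ext (Sym2.map.injective hc.1 this.symm)
  have hsurj := Finite.injective_iff_surjective.1 hinj
  have hsum : ∑ e, (s β e + z.val e) = ∑ _e : H.edgeSet, (1 : ZMod 2) := by
    refine Finset.sum_congr rfl fun e _ => ?_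
    obtain ⟨d, rfl⟩ := hsurj e
    exact hψ2 d
  rw [Finset.sum_add_distrib, hs, z.2, Finset.sum_const, Finset.card_univ, nsmul_eq_mul, mul_one,
    add_zero] at hsum
  exact one_ne_zero (left_eq_add.1 hsum.symm)

-- In characteristic two `z = s b + 1` is even and completes a copy in each row. An `H`-free `g`
-- misses an edge of each of these `B` disjoint copies, out of `B |Z| |E|` equally likely positions.
open Classical in
theorem le_dist_gadgetFunction (φ : Fin B × EvenVector H × V ↪ Fin n) (hB : 0 < B)
    {s : Fin B → H.edgeSet → ZMod 2}
    (hs : ∀ b, ∑ e, s b e = (Fintype.card H.edgeSet : ZMod 2)) {g : Edge n → Bool}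
    (hg : g ∈ freeProperty H n) :
    ((Fintype.card (EvenVector H) : ℝ) * Fintype.card H.edgeSet)⁻¹ ≤
      dist (uniformImage (gadgetEdge (H := H) φ)) (gadgetFunction φ Subtype.val s) g := by
  have hz : ∀ b, ∑ e, (s b e + 1) = 0 := by
    intro b
    rw [Finset.sum_add_distrib, hs, Finset.sum_const, Finset.card_univ, nsmul_eq_mul, mul_one,
      CharTwo.add_self_eq_zero]
  set z : Fin B → EvenVector H := fun b => ⟨fun e => s b e + 1, hz b⟩ with hzdef
  have hlab : ∀ b (e : H.edgeSet), gadgetFunction φ Subtype.val s (gadgetEdge φ (b, z b, e)) = true := by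
    intro b e
    rw [gadgetFunction_gadgetEdge]
    refine decide_eq_true ?_
    simp only [hzdef]
    rw [← add_assoc, CharTwo.add_self_eq_zero, zero_add]
  have hmiss : ∀ b, ∃ e : H.edgeSet, g (gadgetEdge φ (b, z b, e)) = false := by
    intro b
    by_contra! hall
    refine hg (IsCopy.isContained (c := fun v => φ (b, z b, v)) ⟨fun a b hab => by simpa using hab,
      fun a a' h => ?_⟩)
    refine toGraph_adj.2 ⟨gadgetEdge φ (b, z b, ⟨s(a, a'), h⟩), rfl, ?_⟩
    simpa using hall ⟨s(a, a'), h⟩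
  choose e he using hmiss
  have := le_dist_uniformImage (gadgetEdge φ) (gadgetFunction φ Subtype.val s) g
    (fun b => (b, z b, e b)) (fun b b' h => (Prod.mk.inj h).1) fun b => by
      rw [hlab, he]
      exact Bool.false_ne_true.symm
  refine le_trans (le_of_eq ?_) this
  rw [Fintype.card_prod, Fintype.card_prod, Fintype.card_fin]
  have hB' : (B : ℝ) ≠ 0 := by exact_mod_cast hB.ne'
  push_cast
  rw [mul_inv (B : ℝ), ← mul_assoc, mul_inv_cancel₀ hB', one_mul]

end Gadget

open Classical in
/-- A tester sees a whole row of the hidden-parity construction with constant probability. -/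
theorem third_le_of_isTester_freeProperty {V : Type*} [Finite V] {H : SimpleGraph V}
    (hH : H.IsTree) {t n B : ℕ} (ht : 1 ≤ t) (hE : H.edgeSet.ncard = t) (hB : 0 < B)
    (hBn : B * (2 ^ t * (t + 1)) ≤ n) {ε : ℝ} (hε : ε ≤ (2 ^ t * t : ℝ)⁻¹) {m : ℕ}
    {A : Algorithm (Edge n) m} (hA : IsTester (freeProperty H n) ε A) :
    1 / 3 ≤ B * (m / ((t : ℝ) * B)) ^ t := by
  have := Fintype.ofFinite V
  have hcardE : H.edgeFinset.card = t := by
    rw [← hE, ← SimpleGraph.coe_edgeFinset, Set.ncard_coe_finset]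
  have hcardV : Fintype.card V = t + 1 := by rw [← hH.card_edgeFinset, hcardE]
  have hcard : Fintype.card H.edgeSet = t := by rw [← hcardE, SimpleGraph.edgeFinset_card]
  have : Nonempty H.edgeSet := Fintype.card_pos_iff.1 (by omega)
  have hZne : Nonempty (EvenVector H) := ⟨⟨0, by simp⟩⟩
  have hZ : Fintype.card (EvenVector H) ≤ 2 ^ t := by
    refine (Fintype.card_subtype_le _).trans ?_
    rw [Fintype.card_fun, ZMod.card, hcard]
  obtain ⟨φ⟩ : Nonempty (Fin B × EvenVector H × V ↪ Fin n) := by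
    refine Function.Embedding.nonempty_of_card_le ?_
    rw [Fintype.card_prod, Fintype.card_prod, Fintype.card_fin, Fintype.card_fin, hcardV]
    exact le_trans (by gcongr) hBn
  have h := third_le_of_isTester hB (Subtype.val : EvenVector H → _) (gadgetEdge φ)
    (gadgetFunction φ Subtype.val) (gadgetFunction_gadgetEdge φ Subtype.val) hA
    (Fintype.card H.edgeSet : ZMod 2)
    (fun s hs => gadgetFunction_mem_freeProperty hH.connected φ (mem_paritySecrets.1 hs))
    (fun s hs g hg => by
      refine hε.trans (le_trans ?_ (le_dist_gadgetFunction φ hB (mem_paritySecrets.1 hs) hg))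
      have hZ' : (Fintype.card (EvenVector H) : ℝ) ≤ 2 ^ t := by exact_mod_cast hZ
      have hZ0 : (0 : ℝ) < Fintype.card (EvenVector H) := by exact_mod_cast Fintype.card_pos
      have ht0 : (0 : ℝ) < t := by exact_mod_cast ht
      rw [hcard]
      exact inv_anti₀ (by positivity) (by gcongr))
  rwa [hcard] at h

/-- A number of samples of order `n ^ ((t - 1) / t)` is necessary. -/
theorem le_of_isTester_freeProperty {V : Type*} [Finite V] {H : SimpleGraph V}
    (hH : H.IsTree) {t n : ℕ} (ht : 1 ≤ t) (hE : H.edgeSet.ncard = t) {ε : ℝ}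
    (hε : ε ≤ (2 ^ t * t : ℝ)⁻¹) {m : ℕ} (hm : 0 < m)
    {A : Algorithm (Edge n) m} (hA : IsTester (freeProperty H n) ε A) :
    (6 * (2 ^ t * ((t : ℝ) + 1)))⁻¹ * (n : ℝ) ^ (((t : ℝ) - 1) / t) ≤ m := by
  have ht' : (1 : ℝ) ≤ t := by exact_mod_cast ht
  have hm' : (1 : ℝ) ≤ m := by exact_mod_cast hm
  set L : ℕ := 2 ^ t * (t + 1) with hL
  have hL0 : 0 < L := by positivity
  have hLr : (2 : ℝ) ^ t * ((t : ℝ) + 1) = L := by rw [hL]; push_cast; ring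
  have hL1 : (1 : ℝ) ≤ L := by exact_mod_cast hL0
  have hexp0 : 0 ≤ ((t : ℝ) - 1) / t := div_nonneg (by linarith) (by linarith)
  have hexp1 : ((t : ℝ) - 1) / t ≤ 1 := (div_le_one (by linarith)).2 (by linarith)
  rw [hLr, inv_mul_le_iff₀ (by positivity)]
  have hpow : ∀ y : ℝ, 1 ≤ y → y ^ (((t : ℝ) - 1) / t) ≤ y := fun y hy => by
    simpa using Real.rpow_le_rpow_of_exponent_le hy hexp1
  set B := n / L with hBdef
  rcases Nat.eq_zero_or_pos B with hB | hB
  -- Too few vertices for one row: the bound is below `1` and follows from `m ≥ 1`.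
  · have hnL : n ≤ L := ((Nat.div_eq_zero_iff_lt hL0).1 hB).le
    calc (n : ℝ) ^ (((t : ℝ) - 1) / t) ≤ (L : ℝ) ^ (((t : ℝ) - 1) / t) :=
          Real.rpow_le_rpow (by positivity) (by exact_mod_cast hnL) hexp0
      _ ≤ L := hpow _ hL1
      _ ≤ 6 * L * m := by nlinarith
  · have h := third_le_of_isTester_freeProperty hH ht hE hB (Nat.div_mul_le_self n L) hε hA
    have hB' : (1 : ℝ) ≤ B := by exact_mod_cast hB
    set β : ℝ := (B : ℝ) ^ ((t : ℝ)⁻¹) with hβ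
    have hβ0 : 0 < β := by positivity
    have hβt : β ^ t = B := Real.rpow_inv_natCast_pow (by positivity) (by omega)
    have hβt1 : β ^ (t - 1) = (B : ℝ) ^ (((t : ℝ) - 1) / t) := by
      rw [hβ, ← Real.rpow_natCast, ← Real.rpow_mul (by positivity), Nat.cast_sub ht]
      congr 1
      push_cast
      field_simp
    have hβB : (B : ℝ) = β * β ^ (t - 1) := by
      rw [← hβt, ← pow_succ']
      congr 1
      omega
    -- Otherwise `m / (t B) < 1 / (3 β)`, and the probability of seeing a row is below `B / (3 ^ t
    -- B) ≤ 1 / 3`.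
    have hmβ : β ^ (t - 1) ≤ 3 * m := by
      by_contra! hlt
      have h2 : (m : ℝ) / (t * B) < (3 * β)⁻¹ := by
        rw [div_lt_iff₀ (by positivity), hβB]
        have : (3 * β)⁻¹ * (t * (β * β ^ (t - 1))) = t * β ^ (t - 1) / 3 := by
          field_simp
        rw [this]
        nlinarith [pow_pos hβ0 (t - 1)]
      have h3 : ((m : ℝ) / (t * B)) ^ t < (3 * β)⁻¹ ^ t :=
        pow_lt_pow_left₀ h2 (by positivity) (by omega)
      have h4 : (B : ℝ) * (3 * β)⁻¹ ^ t ≤ 1 / 3 := by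
        rw [inv_pow, mul_pow, hβt]
        have h5 : (3 : ℝ) ≤ 3 ^ t := by
          simpa using pow_le_pow_right₀ (show (1 : ℝ) ≤ 3 by norm_num) ht
        rw [mul_inv_le_iff₀ (by positivity)]
        nlinarith
      have h6 := mul_lt_mul_of_pos_left h3 (show (0 : ℝ) < B by linarith)
      linarith
    -- Rounding down in `B = n / L` costs at most a factor two because `B ≥ 1`.
    have hn : (n : ℝ) ≤ 2 * L * B := by
      have h1 := Nat.lt_div_mul_add (a := n) hL0
      have h2 : n ≤ 2 * L * B := by
        rw [← hBdef] at h1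
        nlinarith
      exact_mod_cast h2
    calc (n : ℝ) ^ (((t : ℝ) - 1) / t) ≤ (2 * L * B : ℝ) ^ (((t : ℝ) - 1) / t) :=
          Real.rpow_le_rpow (by positivity) hn hexp0
      _ = (2 * L : ℝ) ^ (((t : ℝ) - 1) / t) * (B : ℝ) ^ (((t : ℝ) - 1) / t) :=
          Real.mul_rpow (by positivity) (by positivity)
      _ ≤ 2 * L * (3 * m) := by
          rw [← hβt1]
          exact mul_le_mul (hpow _ (by linarith)) hmβ (by positivity) (by positivity)
      _ = 6 * L * m := by ring

end EdgeTesting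

/-! ### Assembly of the two bounds -/

theorem theorem5 (t : ℕ) (ht : 1 ≤ t) :
    ∃ ε₀ c C : ℝ, 0 < ε₀ ∧ ε₀ < 1 ∧ 0 < c ∧ 0 < C ∧
      ∀ (V : Type*) [Finite V] (H : SimpleGraph V), H.IsTree → H.edgeSet.ncard = t →
        ∀ n : ℕ, 1 ≤ n → ∀ ε : ℝ, 0 < ε → ε ≤ ε₀ →
          c * (n : ℝ) ^ (((t : ℝ) - 1) / t) ≤
              (EdgeTesting.sam (EdgeTesting.freeProperty H n) ε : ℝ) ∧
            (EdgeTesting.sam (EdgeTesting.freeProperty H n) ε : ℝ) ≤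
              C * (n : ℝ) ^ (((t : ℝ) - 1) / t) / ε := by
  have ht' : (1 : ℝ) ≤ t := by exact_mod_cast ht
  have h2 : (2 : ℝ) ≤ 2 ^ t := by
    simpa using pow_le_pow_right₀ (show (1 : ℝ) ≤ 2 by norm_num) ht
  -- There are only `2 ^ (t - 1)` even vectors; the cruder `2 ^ t` keeps `ε₀ < 1` also for `t = 1`.
  have hε₀ : ((2 : ℝ) ^ t * t)⁻¹ < 1 := inv_lt_one_of_one_lt₀ (by nlinarith)
  refine ⟨((2 : ℝ) ^ t * t)⁻¹, (6 * (2 ^ t * ((t : ℝ) + 1)))⁻¹,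
    t * (2 * t * 3 ^ t * (t * (t + 1) ^ (t + 1)) + 1), by positivity, hε₀, by positivity,
    by positivity, ?_⟩
  intro V _ H hH hE n hn ε hε hεε₀
  obtain ⟨M, hM0, hM, hMle⟩ := EdgeTesting.exists_isTester_freeProperty hH ht hE hn hε
    (hεε₀.trans hε₀.le)
  have hmem : M ∈ {m : ℕ | 0 < m ∧ ∃ A : EdgeTesting.Algorithm (EdgeTesting.Edge n) m,
      EdgeTesting.IsTester (EdgeTesting.freeProperty H n) ε A} := ⟨hM0, hM⟩
  -- The tester of size `M` makes the set nonempty, so the infimum is attained and is not the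
  -- default value `0`.
  obtain ⟨hpos, A, hA⟩ := Nat.sInf_mem ⟨M, hmem⟩
  exact ⟨EdgeTesting.le_of_isTester_freeProperty hH ht hE hεε₀ hpos hA,
    (Nat.cast_le.2 (Nat.sInf_le hmem)).trans hMle⟩
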